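/- Let $n\ge 2$ and $1<p<n$, put $p^*=\frac{np}{n-p}$, let $\Omega\subset\mathbb R^n$ be open and $m\ge 1$. Consider $$J(u,S)=\int_S \sum_{i=1}^m|\nabla u^i|^p+G(x,u,\nabla u)\,dx ,$$ where $G:\Omega\times\mathbb R^m\times\mathbb R^{n\times m}\to\mathbb R$ is a Carathéodory function such that, for a.e. $x\in\Omega$ and all $s_1,s_2\in\mathbb R^m$, $\xi_1,\xi_2\in\mathbb R^{n\times m}$, $$|G(x,s_1,\xi_1)-G(x,s_2,\xi_2)|\le a(x)|s_1-s_2|^{\alpha}(|\xi_1|+|\xi_2|+1)^{q_1}+b(x)(|s_1|+|s_2|+1)^{q_2}|\xi_1-\xi_2|^{\beta},$$ with $0\le q_1<p$, $0\le q_2<p$, $0<\alpha<\min\{1,p-q_1\}$, $0<\beta<\min\{1,p-q_2\}$, nonnegative $a\in L^{\sigma_1}_{loc}(\Omega)$, $b\in L^{\sigma_2}_{loc}(\Omega)$, $\sigma_1>\frac{pp^*}{(p^*-\alpha)p-q_1p^*}$, $\sigma_2>\frac{pp^*}{(p-\beta)p^*-q_2p}$, and $$\frac{q_1}{p}+\frac{\alpha}{p^*}+\frac1{\sigma_1}<\frac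 pn,\qquad \frac{\beta}{p}+\frac{q_2}{p^*}+\frac1{\sigma_2}<\frac pn .$$ Let $\varepsilon>0$ be such that both inequalities still hold, possibly with equality, after $\varepsilon$ is added to the left-hand sides. Let $u\in W^{1,p}(\Omega,\mathbb R^m)$ be a local minimizer of $J$: the integrand $\sum_i|\nabla u^i|^p+G(x,u,\nabla u)$ is integrable on every compact $K'\subset\Omega$, and $J(u,K')\le J(u+\varphi,K')$ for every compact $K'\subset\Omega$ and every $\varphi\in W^{1,p}(\Omega,\mathbb R^m)$ that vanishes outside $K'$ and for which $J(u+\varphi,K')$ is finite. Then for every compact $\Sigma\subset\Omega$ there are constants $C_1,C_2>0$ and a radius $R_0>0$ such that the closed $R_0$-neighbourhood of $\Sigma$ lies in $\Omega$ and, for all $0<\varrho<R<R_0$, all $x_0\in\Sigma$, all $k\in\mathbb R$ and all $i=1,\dots,m$, $$\int_{A^i_{k,\varrho}}|\nabla u^i|^p\,dx\le\frac{C_1}{(R-\varrho)^p}\int_{A^i_{k,R}}(u^i-k)^p\,dx+C_2|A^i_{k,R}|^{1-\frac pn+\varepsilon},$$ $$\int_{B^i_{k,\varrho}}|\nabla u^i|^p\,dx\le\frac{C_1}{(R-\varrho)^p}\int_{B^i_{k,R}}(k-u^i)^p\,dx+C_2|B^i_{k,R}|^{1-\frac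 pn+\varepsilon},$$ where $A^i_{k,r}=\{u^i>k\}\cap B_r(x_0)$ and $B^i_{k,r}=\{u^i<k\}\cap B_r(x_0)$. Here $C_1$ depends only on $n$ and $p$; $R_0$ depends only on $n$, $p$, $\Omega$ and $\Sigma$; and there is a compact set $K\subset\Omega$, containing the closed $R_0$-neighbourhood of $\Sigma$ and depending only on $n,p,\Omega,\Sigma$, such that $C_2$ depends only on $n,p,\Omega,\Sigma,m,q_1,q_2,\alpha,\beta,\sigma_1,\sigma_2,\varepsilon$ and on an upper bound for $\|a\|_{L^{\sigma_1}(K)}$, $\|b\|_{L^{\sigma_2}(K)}$, $\|u\|_{L^p(K)}$ and $\|\nabla u\|_{L^p(K)}$. Consequently, for every open $\Omega'\subset\Sigma$, each component $u^i$ belongs to the De Giorgi class $DG(\Omega',p,C_1,C_2,1,\varepsilon,R_0,0)$. Here $v\in DG(\Omega',p,\lambda,\lambda_*,\chi,\varepsilon,R_0,k_0)$ means that $v\in W^{1,p}_{loc}(\Omega')$ and that for all balls $B_R(x_0)\subset\subset\Omega'$ and all $0<\varrho<R<R_0$ $$\int_{\{v>k\}\cap B_\varrho(x_0)}|\nabla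 v|^p\le\frac{\lambda}{(R-\varrho)^p}\int_{\{v>k\}\cap B_R(x_0)}(v-k)^p+\lambda_*\left(\chi^p+k^pR^{-n\varepsilon}\right)|\{v>k\}\cap B_R(x_0)|^{1-\frac pn+\varepsilon}\quad\text{for all }k\ge k_0,$$ $$\int_{\{v<k\}\cap B_\varrho(x_0)}|\nabla v|^p\le\frac{\lambda}{(R-\varrho)^p}\int_{\{v<k\}\cap B_R(x_0)}(k-v)^p+\lambda_*\left(\chi^p+|k|^pR^{-n\varepsilon}\right)|\{v<k\}\cap B_R(x_0)|^{1-\frac pn+\varepsilon}\quad\text{for all }k\le -k_0 .$$ -/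

import Mathlib

open MeasureTheory Set
open scoped ENNReal NNReal ContDiff

noncomputable section

/-- Euclidean space `ℝⁿ`. -/
abbrev Eucl (n : ℕ) : Type := EuclideanSpace ℝ (Fin n)

/-- The space `ℝ^{n × m}` of gradients of maps `ℝⁿ → ℝᵐ`: `ξ α : ℝⁿ` is the gradient of the
`α`-th component. The norm of `ξ` is the Euclidean (Frobenius) norm. -/
abbrev GradSpace (n m : ℕ) : Type := PiLp 2 (fun _ : Fin m => Eucl n)

/-- `g` is the weak (distributional) gradient of the scalar function `v` on `Ω`. -/
def IsWeakGradient {n : ℕ} (Ω : Set (Eucl n)) (v : Eucl n → ℝ) (g : Eucl n → Eucl n) : Prop :=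
  LocallyIntegrableOn v Ω ∧ LocallyIntegrableOn g Ω ∧
    ∀ ψ : Eucl n → ℝ, ContDiff ℝ ∞ ψ → HasCompactSupport ψ → tsupport ψ ⊆ Ω →
      ∀ i : Fin n,
        ∫ x in Ω, v x * fderiv ℝ ψ x (EuclideanSpace.single i 1) = - ∫ x in Ω, g x i * ψ x

/-- `v ∈ W^{1,p}(Ω)` with weak gradient `g`. -/
def MemW1p {n : ℕ} (Ω : Set (Eucl n)) (p : ℝ) (v : Eucl n → ℝ) (g : Eucl n → Eucl n) : Prop :=
  MemLp v (ENNReal.ofReal p) (volume.restrict Ω) ∧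
    MemLp g (ENNReal.ofReal p) (volume.restrict Ω) ∧ IsWeakGradient Ω v g

/-- `v ∈ W^{1,p}_loc(Ω)` with weak gradient `g`. -/
def MemW1pLoc {n : ℕ} (Ω : Set (Eucl n)) (p : ℝ) (v : Eucl n → ℝ) (g : Eucl n → Eucl n) : Prop :=
  (∀ K : Set (Eucl n), IsCompact K → K ⊆ Ω →
    MemLp v (ENNReal.ofReal p) (volume.restrict K) ∧
      MemLp g (ENNReal.ofReal p) (volume.restrict K)) ∧ IsWeakGradient Ω v g

/-- `u ∈ W^{1,p}(Ω, ℝᵐ)` with weak gradient `Du`, componentwise. -/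
def MemW1pVec {n m : ℕ} (Ω : Set (Eucl n)) (p : ℝ) (u : Eucl n → Eucl m)
    (Du : Eucl n → GradSpace n m) : Prop :=
  ∀ α : Fin m, MemW1p Ω p (fun x => u x α) (fun x => Du x α)

/-- `a ∈ L^σ_loc(Ω)`. -/
def MemLpLoc {n : ℕ} (Ω : Set (Eucl n)) (σ : ℝ) (a : Eucl n → ℝ) : Prop :=
  ∀ K : Set (Eucl n), IsCompact K → K ⊆ Ω → MemLp a (ENNReal.ofReal σ) (volume.restrict K)

/-- The Sobolev exponent `p* = np / (n - p)`. -/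
def sobolevExp (n : ℕ) (p : ℝ) : ℝ := n * p / (n - p)

/-- The conditions on the exponents in the structure hypothesis on `G`. -/
structure ExponentCond (n : ℕ) (p q₁ q₂ α β σ₁ σ₂ : ℝ) : Prop where
  q₁_nonneg : 0 ≤ q₁
  q₁_lt : q₁ < p
  q₂_nonneg : 0 ≤ q₂
  q₂_lt : q₂ < p
  α_pos : 0 < α
  α_lt : α < min 1 (p - q₁)
  β_pos : 0 < β
  β_lt : β < min 1 (p - q₂)
  σ₁_gt : p * sobolevExp n p / ((sobolevExp n p - α) * p - q₁ * sobolevExp n p) < σ₁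
  σ₂_gt : p * sobolevExp n p / ((p - β) * sobolevExp n p - q₂ * p) < σ₂
  small₁ : q₁ / p + α / sobolevExp n p + 1 / σ₁ < p / n
  small₂ : β / p + q₂ / sobolevExp n p + 1 / σ₂ < p / n

/-- `G : Ω × ℝᵐ × ℝ^{n × m} → ℝ` is a Carathéodory function: measurable in `x`, and
continuous in `(s, ξ)` for almost every `x`. -/
def IsCaratheodoryFun {n m : ℕ} (Ω : Set (Eucl n))
    (G : Eucl n → Eucl m → GradSpace n m → ℝ) : Prop :=
  (∀ s ξ, AEMeasurable (fun x => G x s ξ) (volume.restrict Ω)) ∧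
    ∀ᵐ x ∂(volume.restrict Ω), Continuous (fun z : Eucl m × GradSpace n m => G x z.1 z.2)

/-- The structure hypothesis on the density `G`, with the coefficients `a` and `b`. -/
structure StructureCond {n m : ℕ} (Ω : Set (Eucl n)) (q₁ q₂ α β σ₁ σ₂ : ℝ)
    (G : Eucl n → Eucl m → GradSpace n m → ℝ) (a b : Eucl n → ℝ) : Prop where
  caratheodory : IsCaratheodoryFun Ω G
  a_nonneg : ∀ᵐ x ∂(volume.restrict Ω), 0 ≤ a x
  b_nonneg : ∀ᵐ x ∂(volume.restrict Ω), 0 ≤ b x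
  a_mem : MemLpLoc Ω σ₁ a
  b_mem : MemLpLoc Ω σ₂ b
  growth : ∀ᵐ x ∂(volume.restrict Ω), ∀ (s₁ s₂ : Eucl m) (ξ₁ ξ₂ : GradSpace n m),
    |G x s₁ ξ₁ - G x s₂ ξ₂| ≤
      a x * ‖s₁ - s₂‖ ^ α * (‖ξ₁‖ + ‖ξ₂‖ + 1) ^ q₁ +
        b x * (‖s₁‖ + ‖s₂‖ + 1) ^ q₂ * ‖ξ₁ - ξ₂‖ ^ β

/-- The integrand `∑_α |∇u^α|^p + G(x, u, ∇u)`. -/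
def energyDensity {n m : ℕ} (p : ℝ) (G : Eucl n → Eucl m → GradSpace n m → ℝ)
    (u : Eucl n → Eucl m) (Du : Eucl n → GradSpace n m) (x : Eucl n) : ℝ :=
  (∑ α : Fin m, ‖Du x α‖ ^ p) + G x (u x) (Du x)

/-- The functional `J(u, S) = ∫_S ∑_α |∇u^α|^p + G(x, u, ∇u) dx`. -/
def energy {n m : ℕ} (p : ℝ) (G : Eucl n → Eucl m → GradSpace n m → ℝ)
    (u : Eucl n → Eucl m) (Du : Eucl n → GradSpace n m) (S : Set (Eucl n)) : ℝ :=
  ∫ x in S, energyDensity p G u Du x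

/-- `u ∈ W^{1,p}(Ω, ℝᵐ)` (with weak gradient `Du`) is a local minimizer of `J`: its energy is
finite on compact subsets of `Ω`, and `J(u, K) ≤ J(u + φ, K)` for every compact `K ⊆ Ω` and every
`φ ∈ W^{1,p}(Ω, ℝᵐ)` that vanishes outside `K` and for which `J(u + φ, K)` is finite. -/
def IsLocalMinimizer {n m : ℕ} (Ω : Set (Eucl n)) (p : ℝ)
    (G : Eucl n → Eucl m → GradSpace n m → ℝ)
    (u : Eucl n → Eucl m) (Du : Eucl n → GradSpace n m) : Prop :=
  MemW1pVec Ω p u Du ∧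
    (∀ K : Set (Eucl n), IsCompact K → K ⊆ Ω → IntegrableOn (energyDensity p G u Du) K) ∧
    ∀ K : Set (Eucl n), IsCompact K → K ⊆ Ω →
      ∀ (φ : Eucl n → Eucl m) (Dφ : Eucl n → GradSpace n m), MemW1pVec Ω p φ Dφ →
        (∀ x, x ∉ K → φ x = 0) →
        IntegrableOn (energyDensity p G (u + φ) (Du + Dφ)) K →
        energy p G u Du K ≤ energy p G (u + φ) (Du + Dφ) K

/-- The super-level set `A_{k,r} = {v > k} ∩ B_r(x₀)`. -/
def superLevel {n : ℕ} (v : Eucl n → ℝ) (k : ℝ) (x₀ : Eucl n) (r : ℝ) : Set (Eucl n) :=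
  {x | k < v x} ∩ Metric.ball x₀ r

/-- The sub-level set `B_{k,r} = {v < k} ∩ B_r(x₀)`. -/
def subLevel {n : ℕ} (v : Eucl n → ℝ) (k : ℝ) (x₀ : Eucl n) (r : ℝ) : Set (Eucl n) :=
  {x | v x < k} ∩ Metric.ball x₀ r

/-- The De Giorgi class `DG⁺(Ω, p, lam, lam', χ, ε, R₀, k₀)`, for a bounded open set `Ω`. -/
def MemDeGiorgiPlus {n : ℕ} (Ω : Set (Eucl n)) (p lam lam' χ ε R₀ k₀ : ℝ)
    (v : Eucl n → ℝ) : Prop :=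
  IsOpen Ω ∧ Bornology.IsBounded Ω ∧
  1 < p ∧ 0 < lam ∧ 0 < lam' ∧ 0 < χ ∧ 0 < ε ∧ 0 < R₀ ∧ 0 ≤ k₀ ∧
  ∃ g : Eucl n → Eucl n, MemW1pLoc Ω p v g ∧
    ∀ k : ℝ, k₀ ≤ k → ∀ (x₀ : Eucl n) (ρ R : ℝ), 0 < ρ → ρ < R → R < R₀ →
      Metric.closedBall x₀ R ⊆ Ω →
      ∫ x in superLevel v k x₀ ρ, ‖g x‖ ^ p ≤
        lam / (R - ρ) ^ p * (∫ x in superLevel v k x₀ R, (v x - k) ^ p) +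
          lam' * (χ ^ p + k ^ p * R ^ (-(n * ε))) *
            volume.real (superLevel v k x₀ R) ^ (1 - p / n + ε)

/-- The De Giorgi class `DG⁻(Ω, p, lam, lam', χ, ε, R₀, k₀)`, for a bounded open set `Ω`. -/
def MemDeGiorgiMinus {n : ℕ} (Ω : Set (Eucl n)) (p lam lam' χ ε R₀ k₀ : ℝ)
    (v : Eucl n → ℝ) : Prop :=
  IsOpen Ω ∧ Bornology.IsBounded Ω ∧
  1 < p ∧ 0 < lam ∧ 0 < lam' ∧ 0 < χ ∧ 0 < ε ∧ 0 < R₀ ∧ 0 ≤ k₀ ∧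
  ∃ g : Eucl n → Eucl n, MemW1pLoc Ω p v g ∧
    ∀ k : ℝ, k ≤ -k₀ → ∀ (x₀ : Eucl n) (ρ R : ℝ), 0 < ρ → ρ < R → R < R₀ →
      Metric.closedBall x₀ R ⊆ Ω →
      ∫ x in subLevel v k x₀ ρ, ‖g x‖ ^ p ≤
        lam / (R - ρ) ^ p * (∫ x in subLevel v k x₀ R, (k - v x) ^ p) +
          lam' * (χ ^ p + |k| ^ p * R ^ (-(n * ε))) *
            volume.real (subLevel v k x₀ R) ^ (1 - p / n + ε)

/-- The De Giorgi class `DG = DG⁺ ∩ DG⁻`. -/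
def MemDeGiorgi {n : ℕ} (Ω : Set (Eucl n)) (p lam lam' χ ε R₀ k₀ : ℝ)
    (v : Eucl n → ℝ) : Prop :=
  MemDeGiorgiPlus Ω p lam lam' χ ε R₀ k₀ v ∧ MemDeGiorgiMinus Ω p lam lam' χ ε R₀ k₀ v

end

/-! On a ball B_R and at a level k, compare u with u − f e_i, where f = η^N (u^i − k)₊, η is a
cutoff between B_ϱ and B_R, and N ≥ p is an integer. Only the i-th component changes, so the
p-energies of the others cancel, and minimality bounds ∫|∇u^i|^p by ∫|∇u^i − ∇f|^p plus the
variation of G (`IsLocalMinimizer.setIntegral_rpow_le`). On {u^i > k}, where η > 0, ∇u^i − ∇f is the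
convex combination, with weights 1 − η^N and η^N, of ∇u^i and −(N/η)(u^i − k)∇η. Convexity of t^p
(`norm_sub_cutoff_rpow_le`) then yields ∫P ≤ ∫Q + (variation of G), with P = η^N|∇(u^i − k)₊|^p and
Q = N^p|(u^i − k)₊∇η|^p. Since P carries the full weight η^N, no hole filling or iteration over
radii is needed, and the constant of the Q-term involves no data of G.

The variation of G is estimated in `exists_lintegral_variationBound_le`. Hölder's inequality with a
in L^σ₁, f in L^p* and the gradients in L^p leaves the power 1 − 1/σ₁ − α/p* − q₁/p of |A_{k,R}|,
which is at least 1 − p/n + ε; the b-term is similar. Sobolev's inequality bounds f in L^p* by ∇f in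
L^p, and the total power of ‖∇f‖_p stays below p because α + q₁ < p and β + q₂ < p. Hence the
variation is at most δ‖∇f‖_p^p + C|A_{k,R}|^{1−p/n+ε}. As ∫|∇f|^p ≤ 2^p(∫P + ∫Q), a small δ lets the
left side absorb the P-part (`exists_caccioppoli_superLevel`).

Sobolev's inequality and the chain rule for positive parts are derived from the distributional
definition of the gradient by mollification. Sub-level sets follow by applying the result to −u,
which minimizes the functional with density G(x, −s, −ξ). The De Giorgi inequalities only add a
nonnegative k-dependent term on the right. -/

/-! ### Mollification of functions with a weak gradient -/

open Filter Topology Convolution in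
-- The derivative falls on the kernel, and the translated, reflected kernel y ↦ ρ(x − y) is an
-- admissible test function. The sign produced by the reflection cancels the one in the definition
-- of the weak gradient.
theorem IsWeakGradient.hasFDerivAt_convolution {n : ℕ} {f : Eucl n → ℝ} {F : Eucl n → Eucl n}
    (h : IsWeakGradient univ f F) {ρ : Eucl n → ℝ} (hρ : ContDiff ℝ ∞ ρ)
    (hc : HasCompactSupport ρ) (x : Eucl n) :
    HasFDerivAt (ρ ⋆[ContinuousLinearMap.lsmul ℝ ℝ, volume] f)
      (innerSL ℝ ((ρ ⋆[ContinuousLinearMap.lsmul ℝ ℝ, volume] F) x)) x := by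
  obtain ⟨hf, hF, hw⟩ := h
  rw [locallyIntegrableOn_univ] at hf hF
  have hρ1 : ContDiff ℝ 1 ρ := hρ.of_le (by exact_mod_cast le_top)
  have H := hc.hasFDerivAt_convolution_left (ContinuousLinearMap.lsmul ℝ ℝ) hρ1 hf x
  convert! H using 1
  refine ContinuousLinearMap.coe_injective
    ((EuclideanSpace.basisFun (Fin n) ℝ).toBasis.ext fun i => ?_)
  have e1 : Integrable (fun t => ρ t • F (x - t)) volume :=
    (hc.convolutionExists_left (ContinuousLinearMap.lsmul ℝ ℝ) hρ.continuous hF x).integrable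
  have e2 := (hc.fderiv ℝ).convolutionExists_left
    ((ContinuousLinearMap.lsmul ℝ ℝ : ℝ →L[ℝ] ℝ →L[ℝ] ℝ).precompL (Eucl n))
    (hρ1.continuous_fderiv one_ne_zero) hf x
  have hψ := hw (fun y => ρ (x - y)) (hρ.comp (contDiff_const.sub contDiff_id))
    (hc.comp_homeomorph (Homeomorph.subLeft x)) (subset_univ _) i
  have hd : ∀ y, fderiv ℝ (fun y => ρ (x - y)) y = - fderiv ℝ ρ (x - y) := fun y => by
    have := ((hρ1.differentiable one_ne_zero (x - y)).hasFDerivAt.comp y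
      ((hasFDerivAt_const x y).sub (hasFDerivAt_id y))).fderiv
    refine this.trans ?_
    ext v
    simp
  have l1 : (ρ ⋆[ContinuousLinearMap.lsmul ℝ ℝ, volume] F) x i = ∫ y, F y i * ρ (x - y) := by
    rw [convolution_def]
    have := ((EuclideanSpace.proj i : Eucl n →L[ℝ] ℝ)).integral_comp_comm e1
    simp only [ContinuousLinearMap.lsmul_apply]
    refine (this.symm.trans ?_)
    rw [← integral_sub_left_eq_self _ volume x]
    simp [mul_comm]
  have l2 : ((fderiv ℝ ρ) ⋆[(ContinuousLinearMap.lsmul ℝ ℝ : ℝ →L[ℝ] ℝ →L[ℝ] ℝ).precompL (Eucl n), volume] f) x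
      (EuclideanSpace.single i 1) = ∫ y, f y * fderiv ℝ ρ (x - y) (EuclideanSpace.single i 1) := by
    rw [convolution_def, ContinuousLinearMap.integral_apply e2.integrable]
    rw [← integral_sub_left_eq_self _ volume x]
    simp [mul_comm, ContinuousLinearMap.precompL_apply]
  simp only [Measure.restrict_univ, hd, neg_apply, mul_neg, integral_neg,
    neg_inj] at hψ
  simp only [OrthonormalBasis.coe_toBasis, EuclideanSpace.basisFun_apply,
    ContinuousLinearMap.coe_coe, innerSL_apply_apply]
  rw [l2, hψ, ← l1]
  simp [EuclideanSpace.inner_single_right]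

open ENNReal in
/-- Jensen's inequality and Tonelli's theorem: averaging of translates is an `L^p` contraction. -/
theorem lintegral_rpow_average_le {n : ℕ} {p : ℝ} (hp : 1 ≤ p) {r H : Eucl n → ℝ≥0∞}
    (hr : Measurable r) (hr1 : ∫⁻ t, r t = 1) (hH : AEMeasurable H) :
    ∫⁻ x, (∫⁻ t, r t * H (x - t)) ^ p ≤ ∫⁻ x, H x ^ p := by
  have hp0 : 0 < p := zero_lt_one.trans_le hp
  wlog hHm : Measurable H generalizing H
  · have := this hH.measurable_mk.aemeasurable hH.measurable_mk
    have e : ∀ x, ∫⁻ t, r t * H (x - t) = ∫⁻ t, r t * hH.mk H (x - t) := fun x => by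
      refine lintegral_congr_ae ?_
      have := (Measure.measurePreserving_sub_left volume x).quasiMeasurePreserving.ae_eq_comp
        hH.ae_eq_mk
      filter_upwards [this] with t ht
      simp only [Function.comp_apply] at ht
      rw [ht]
    simp only [e]
    refine this.trans (le_of_eq (lintegral_congr_ae ?_))
    filter_upwards [hH.ae_eq_mk] with x hx
    rw [hx]
  have hH2 : Measurable (Function.uncurry fun x t : Eucl n => r t * H (x - t) ^ p) := by
    unfold Function.uncurry
    fun_prop
  calc ∫⁻ x, (∫⁻ t, r t * H (x - t)) ^ p ≤ ∫⁻ x, ∫⁻ t, r t * H (x - t) ^ p := by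
        refine lintegral_mono fun x => ?_
        -- Jensen's inequality is the monotonicity of L^p norms in p for the probability measure r
        -- dt.
        have : IsProbabilityMeasure (volume.withDensity r) :=
          ⟨by rw [withDensity_apply _ MeasurableSet.univ]; simpa using hr1⟩
        have hm : Measurable fun t => H (x - t) := by fun_prop
        have := eLpNorm_le_eLpNorm_of_exponent_le (μ := volume.withDensity r)
          (p := 1) (q := ENNReal.ofReal p) (by simpa using hp) hm.aestronglyMeasurable
        rw [eLpNorm_one_eq_lintegral_enorm, eLpNorm_eq_lintegral_rpow_enorm_toReal
          (by simpa using hp0) (by simp), ENNReal.toReal_ofReal hp0.le] at this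
        simp only [enorm_eq_self] at this
        rw [lintegral_withDensity_eq_lintegral_mul _ hr hm,
          lintegral_withDensity_eq_lintegral_mul _ hr (hm.pow_const p)] at this
        have h2 := ENNReal.rpow_le_rpow this hp0.le
        rw [← ENNReal.rpow_mul, one_div_mul_cancel hp0.ne', ENNReal.rpow_one] at h2
        exact h2
    _ = ∫⁻ t, ∫⁻ x, r t * H (x - t) ^ p := lintegral_lintegral_swap hH2.aemeasurable
    _ = ∫⁻ t, r t * ∫⁻ x, H x ^ p := by
        refine lintegral_congr fun t => ?_
        rw [lintegral_const_mul _ (by fun_prop)]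
        congr 1
        exact lintegral_sub_right_eq_self (fun x => H x ^ p) t
    _ = ∫⁻ x, H x ^ p := by
        rw [lintegral_mul_const _ hr, hr1, one_mul]

open Filter Topology in
/-- Dominated convergence with dominating functions that vary with the index. -/
theorem tendsto_lintegral_zero_of_le_add {X : Type*} [MeasurableSpace X] {μ : Measure X}
    {D H : ℕ → X → ℝ≥0∞} {h : X → ℝ≥0∞} (hD : ∀ j, AEMeasurable (D j) μ)
    (hH : ∀ j, AEMeasurable (H j) μ) (hh : AEMeasurable h μ) (hle : ∀ j x, D j x ≤ H j x + h x)
    (hDt : ∀ᵐ x ∂μ, Tendsto (fun j => D j x) atTop (𝓝 0))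
    (hHt : ∀ᵐ x ∂μ, Tendsto (fun j => H j x) atTop (𝓝 (h x)))
    (hHi : ∀ j, ∫⁻ x, H j x ∂μ ≤ ∫⁻ x, h x ∂μ) (hhi : ∫⁻ x, h x ∂μ ≠ ⊤) :
    Tendsto (fun j => ∫⁻ x, D j x ∂μ) atTop (𝓝 0) := by
  set I := ∫⁻ x, h x ∂μ
  have hsum : ∀ j, ∫⁻ x, (H j x + h x - D j x) ∂μ + ∫⁻ x, D j x ∂μ ≤ I + I := fun j => by
    rw [← lintegral_add_right' _ (hD j)]
    refine (lintegral_congr fun x => tsub_add_cancel_of_le (hle j x)).trans_le ?_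
    rw [lintegral_add_right' _ hh]
    exact add_le_add_left (hHi j) _
  -- Fatou's lemma for the nonnegative functions H_j + h − D_j, which converge a.e. to 2h.
  have hfat : I + I ≤ liminf (fun j => ∫⁻ x, (H j x + h x - D j x) ∂μ) atTop := by
    refine le_trans (le_of_eq ?_) (lintegral_liminf_le' fun j => ((hH j).add hh).sub (hD j))
    rw [← lintegral_add_right' _ hh]
    refine lintegral_congr_ae ?_
    filter_upwards [hDt, hHt] with x h1 h2
    have := ENNReal.Tendsto.sub (h2.add (tendsto_const_nhds (x := h x))) h1 (Or.inr (by simp))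
    rw [tsub_zero] at this
    exact this.liminf_eq.symm
  have hII : I + I ≠ ⊤ := by simp [hhi]
  rw [ENNReal.tendsto_nhds_zero]
  intro ε hε
  by_cases h0 : I + I = 0
  · refine Eventually.of_forall fun j => ?_
    have := hsum j
    rw [h0] at this
    exact (le_add_self.trans this).trans zero_le
  have hlt : I + I - ε < liminf (fun j => ∫⁻ x, (H j x + h x - D j x) ∂μ) atTop :=
    (ENNReal.sub_lt_self hII h0 hε.ne').trans_le hfat
  filter_upwards [eventually_lt_of_lt_liminf hlt] with j hj
  have hs : ∫⁻ x, (H j x + h x - D j x) ∂μ ≠ ⊤ :=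
    ne_top_of_le_ne_top hII (le_self_add.trans (hsum j))
  have h3 : I + I ≤ ∫⁻ x, (H j x + h x - D j x) ∂μ + ε := by
    rw [← tsub_le_iff_right]; exact hj.le
  exact (ENNReal.add_le_add_iff_left hs).1 ((hsum j).trans h3)

/-- A sequence of bump functions at the origin with shrinking supports. -/
noncomputable def mollifierBump (n j : ℕ) : ContDiffBump (0 : Eucl n) where
  rIn := 1 / ((j : ℝ) + 1) / 2
  rOut := 1 / ((j : ℝ) + 1)
  rIn_pos := by positivity
  rIn_lt_rOut := half_lt_self (by positivity)

/-- Convolution with the `j`-th mollifier. -/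
noncomputable def mollify {n : ℕ} {V : Type*} [NormedAddCommGroup V] [NormedSpace ℝ V] (j : ℕ)
    (f : Eucl n → V) : Eucl n → V :=
  convolution ((mollifierBump n j).normed volume) f (ContinuousLinearMap.lsmul ℝ ℝ) volume

section Mollify

variable {n : ℕ} {V : Type*} [NormedAddCommGroup V] [NormedSpace ℝ V]

theorem lintegral_mollifierBump (n j : ℕ) :
    ∫⁻ t, ENNReal.ofReal ((mollifierBump n j).normed volume t) = 1 := by
  rw [← ofReal_integral_eq_lintegral_ofReal (mollifierBump n j).integrable_normed
    (Filter.Eventually.of_forall fun t => (mollifierBump n j).nonneg_normed t),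
    (mollifierBump n j).integral_normed, ENNReal.ofReal_one]

theorem enorm_mollify_le (j : ℕ) (f : Eucl n → V) (x : Eucl n) :
    ‖mollify j f x‖ₑ ≤
      ∫⁻ t, ENNReal.ofReal ((mollifierBump n j).normed volume t) * ‖f (x - t)‖ₑ := by
  refine (enorm_integral_le_lintegral_enorm _).trans (le_of_eq (lintegral_congr fun t => ?_))
  rw [ContinuousLinearMap.lsmul_apply, enorm_smul,
    Real.enorm_eq_ofReal ((mollifierBump n j).nonneg_normed t)]

theorem lintegral_enorm_mollify_rpow_le {p : ℝ} (hp : 1 ≤ p) (j : ℕ) {f : Eucl n → V}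
    (hf : AEStronglyMeasurable f) :
    ∫⁻ x, ‖mollify j f x‖ₑ ^ p ≤ ∫⁻ x, ‖f x‖ₑ ^ p := by
  refine (lintegral_mono fun x => ENNReal.rpow_le_rpow (enorm_mollify_le j f x)
    (zero_le_one.trans hp)).trans ?_
  exact lintegral_rpow_average_le hp ((mollifierBump n j).continuous_normed.measurable.ennreal_ofReal)
    (lintegral_mollifierBump n j) hf.enorm

theorem eLpNorm_mollify_le {p : ℝ} (hp : 1 ≤ p) (j : ℕ) {f : Eucl n → V}
    (hf : AEStronglyMeasurable f) :
    eLpNorm (mollify j f) (ENNReal.ofReal p) volume ≤ eLpNorm f (ENNReal.ofReal p) volume := by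
  have hp0 : 0 < p := zero_lt_one.trans_le hp
  rw [eLpNorm_eq_lintegral_rpow_enorm_toReal (by simpa using hp0) (by simp),
    eLpNorm_eq_lintegral_rpow_enorm_toReal (by simpa using hp0) (by simp),
    ENNReal.toReal_ofReal hp0.le]
  exact ENNReal.rpow_le_rpow (lintegral_enorm_mollify_rpow_le hp j hf) (by positivity)

theorem ae_tendsto_mollify [CompleteSpace V] {f : Eucl n → V} (hf : LocallyIntegrable f) :
    ∀ᵐ x, Filter.Tendsto (fun j => mollify j f x) Filter.atTop (nhds (f x)) := by
  refine ContDiffBump.ae_convolution_tendsto_right_of_locallyIntegrable (K := 2)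
    tendsto_one_div_add_atTop_nhds_zero_nat (Filter.Eventually.of_forall fun j => ?_) hf
  simp only [mollifierBump]
  linarith

theorem continuous_mollify [CompleteSpace V] (j : ℕ) {f : Eucl n → V} (hf : LocallyIntegrable f) :
    Continuous (mollify j f) :=
  (mollifierBump n j).hasCompactSupport_normed.continuous_convolution_left _
    (mollifierBump n j).continuous_normed hf

/-- The majorants A(|g_j| + |g|) depend on j, but they converge a.e., and ∫|g_j| ≤ ∫|g| since
mollification contracts L¹. This is what dominated convergence with varying majorants requires. -/
theorem tendsto_integral_of_le_enorm_mollify [CompleteSpace V] {g : Eucl n → V}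
    (hg : Integrable g) {u : ℕ → Eucl n → ℝ} {v : Eucl n → ℝ} (hu : ∀ j, Integrable (u j))
    (hv : AEStronglyMeasurable v) {A : ℝ≥0}
    (hle : ∀ j x, ‖u j x - v x‖ₑ ≤ A * (‖mollify j g x‖ₑ + ‖g x‖ₑ))
    (ht : ∀ᵐ x, Filter.Tendsto (fun j => u j x) Filter.atTop (nhds (v x))) :
    Filter.Tendsto (fun j => ∫ x, u j x) Filter.atTop (nhds (∫ x, v x)) := by
  refine tendsto_integral_of_L1 v hv (Filter.Eventually.of_forall hu) ?_
  refine tendsto_lintegral_zero_of_le_add (H := fun j x => A * ‖mollify j g x‖ₑ)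
    (h := fun x => A * ‖g x‖ₑ) (fun j => ((hu j).1.sub hv).enorm) (fun j => ?_)
    (hg.1.enorm.const_mul _) (fun j x => (hle j x).trans_eq (mul_add ..)) ?_ ?_ (fun j => ?_) ?_
  · exact ((continuous_mollify j hg.locallyIntegrable).aestronglyMeasurable.enorm).const_mul _
  · filter_upwards [ht] with x hx
    have := (hx.sub_const (v x)).enorm
    simpa using this
  · filter_upwards [ae_tendsto_mollify hg.locallyIntegrable] with x hx
    exact ENNReal.Tendsto.const_mul hx.enorm (Or.inr (by simp))
  · rw [lintegral_const_mul' _ _ (by simp), lintegral_const_mul' _ _ (by simp)]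
    exact mul_le_mul' le_rfl (by simpa using lintegral_enorm_mollify_rpow_le le_rfl j hg.1)
  · rw [lintegral_const_mul' _ _ (by simp)]
    exact ENNReal.mul_ne_top (by simp) hg.2.ne

theorem IsWeakGradient.hasFDerivAt_mollify {f : Eucl n → ℝ} {F : Eucl n → Eucl n}
    (h : IsWeakGradient univ f F) (j : ℕ) (x : Eucl n) :
    HasFDerivAt (mollify j f) (innerSL ℝ (mollify j F x)) x :=
  h.hasFDerivAt_convolution (mollifierBump n j).contDiff_normed
    (mollifierBump n j).hasCompactSupport_normed x

end Mollify

/-! ### Sobolev's inequality and the C¹ chain rule -/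

/-- The **Sobolev inequality** for compactly supported functions in `W^{1,p}(ℝⁿ)`. -/
theorem IsWeakGradient.exists_sobolev {n : ℕ} (hn : 0 < n) {p : ℝ} (hp1 : 1 ≤ p) (hpn : p < n) :
    ∃ C : ℝ≥0, ∀ (f : Eucl n → ℝ) (F : Eucl n → Eucl n), IsWeakGradient univ f F →
      HasCompactSupport f →
      eLpNorm f (ENNReal.ofReal (sobolevExp n p)) volume ≤
        C * eLpNorm F (ENNReal.ofReal p) volume := by
  have hp0 : 0 < p := zero_lt_one.trans_le hp1
  refine ⟨SNormLESNormFDerivOfEqConst ℝ (volume : Measure (Eucl n)) p.toNNReal,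
    fun f F h hf => ?_⟩
  have hfl : LocallyIntegrable f := locallyIntegrableOn_univ.1 h.1
  have hFl : LocallyIntegrable F := locallyIntegrableOn_univ.1 h.2.1
  have hbound : ∀ j, eLpNorm (mollify j f) (ENNReal.ofReal (sobolevExp n p)) volume ≤
      SNormLESNormFDerivOfEqConst ℝ (volume : Measure (Eucl n)) p.toNNReal *
        eLpNorm F (ENNReal.ofReal p) volume := fun j => by
    have hd : fderiv ℝ (mollify j f) = fun x => innerSL ℝ (mollify j F x) :=
      funext fun x => (h.hasFDerivAt_mollify j x).fderiv
    have hsm : ContDiff ℝ 1 (mollify j f) :=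
      (mollifierBump n j).hasCompactSupport_normed.contDiff_convolution_left _
        (mollifierBump n j).contDiff_normed hfl
    have hcs : HasCompactSupport (mollify j f) :=
      HasCompactSupport.convolution _ (mollifierBump n j).hasCompactSupport_normed hf
    have := eLpNorm_le_eLpNorm_fderiv_of_eq (volume : Measure (Eucl n)) hsm hcs
      (p := p.toNNReal) (p' := (sobolevExp n p).toNNReal) (by simpa using hp1)
      (by simpa using hn) (by
        have : 0 ≤ sobolevExp n p := by
          unfold sobolevExp
          exact div_nonneg (by positivity) (sub_pos.2 hpn).le
        have hn' : (0 : ℝ) < n := by exact_mod_cast hn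
        rw [Real.coe_toNNReal _ this, NNReal.coe_inv, Real.coe_toNNReal _ hp0.le, finrank_euclideanSpace_fin,
          sobolevExp]
        have := (sub_pos.2 hpn).ne'
        field_simp)
    refine this.trans (mul_le_mul' le_rfl ?_)
    rw [hd]
    refine le_trans (le_of_eq ?_) (eLpNorm_mollify_le hp1 j hFl.aestronglyMeasurable)
    exact eLpNorm_congr_norm_ae (Filter.Eventually.of_forall fun x => innerSL_apply_norm ..)
  -- The bound for the mollifications is uniform in j, so Fatou's lemma passes it to f.
  refine (Lp.eLpNorm_lim_le_liminf_eLpNorm (f := fun j => mollify j f)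
    (fun j => (continuous_mollify j hfl).aestronglyMeasurable) f (ae_tendsto_mollify hfl)).trans ?_
  refine (Filter.liminf_le_liminf (Filter.Eventually.of_forall hbound)).trans ?_
  simp

open Filter Topology in
-- Classical integration by parts holds for Φ(f_j) with f_j the mollification of f. Both sides
-- converge: Φ is 1-Lipschitz, so the left integrands are controlled by |f_j| + |f|, and |Φ'| ≤ 1
-- controls the right ones by |F_j| + |F|.
theorem IsWeakGradient.integral_comp_mul_fderiv {n : ℕ} {f : Eucl n → ℝ} {F : Eucl n → Eucl n}
    (h : IsWeakGradient univ f F) (hf : Integrable f) (hF : Integrable F) {Φ Φ' : ℝ → ℝ}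
    (hΦ : ∀ t, HasDerivAt Φ (Φ' t) t) (hΦc : Continuous Φ') (hΦ1 : ∀ t, |Φ' t| ≤ 1)
    {ψ : Eucl n → ℝ} (hψ : ContDiff ℝ ∞ ψ) (hc : HasCompactSupport ψ) (i : Fin n) :
    ∫ x, Φ (f x) * fderiv ℝ ψ x (EuclideanSpace.single i 1) =
      - ∫ x, Φ' (f x) * F x i * ψ x := by
  have hψ1 : ContDiff ℝ 1 ψ := hψ.of_le (by exact_mod_cast le_top)
  have hΦcont : Continuous Φ := continuous_iff_continuousAt.2 fun t => (hΦ t).continuousAt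
  have hlip : ∀ s t, |Φ s - Φ t| ≤ |s - t| := fun s t => by
    have := Convex.norm_image_sub_le_of_norm_hasDerivWithin_le (C := 1) (s := univ) (x := t) (y := s)
      (fun t _ => (hΦ t).hasDerivWithinAt) (fun t _ => by simpa using hΦ1 t) convex_univ
      (mem_univ _) (mem_univ _)
    simpa using this
  set e : Eucl n := EuclideanSpace.single i 1
  have hdc : Continuous fun x => fderiv ℝ ψ x e := (hψ1.continuous_fderiv one_ne_zero).clm_apply
    continuous_const
  have hdcs : HasCompactSupport fun x => fderiv ℝ ψ x e := hc.fderiv_apply ℝ e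
  obtain ⟨A, hA⟩ := hdc.bounded_above_of_compact_support hdcs
  obtain ⟨B, hB⟩ := hψ.continuous.bounded_above_of_compact_support hc
  have hA0 : 0 ≤ A := (norm_nonneg _).trans (hA 0)
  have hB0 : 0 ≤ B := (norm_nonneg _).trans (hB 0)
  have hcm : ∀ j, Continuous (mollify j f) := fun j => continuous_mollify j hf.locallyIntegrable
  have hcM : ∀ j, Continuous (mollify j F) := fun j => continuous_mollify j hF.locallyIntegrable
  have hparts : ∀ j, ∫ x, Φ (mollify j f x) * fderiv ℝ ψ x e =
      - ∫ x, Φ' (mollify j f x) * mollify j F x i * ψ x := fun j => by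
    have hd : ∀ x, HasFDerivAt (fun x => Φ (mollify j f x))
        (Φ' (mollify j f x) • innerSL ℝ (mollify j F x)) x := fun x =>
      (hΦ _).comp_hasFDerivAt x (h.hasFDerivAt_mollify j x)
    have hde : ∀ x, fderiv ℝ (fun x => Φ (mollify j f x)) x e =
        Φ' (mollify j f x) * mollify j F x i := fun x => by
      rw [(hd x).fderiv]
      simp [e, EuclideanSpace.inner_single_right]
    have hci : Continuous fun x => mollify j F x i := by
      have := hcM j
      fun_prop
    have := integral_mul_fderiv_eq_neg_fderiv_mul_of_integrable (μ := volume)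
      (f := fun x => Φ (mollify j f x)) (g := ψ) (v := e) ?_ ?_ ?_
      (fun x _ => (hd x).differentiableAt) (fun x _ => hψ1.differentiable one_ne_zero x)
    · simpa only [hde] using this
    · simp only [hde]
      exact (((hΦc.comp (hcm j)).mul hci).mul hψ.continuous).integrable_of_hasCompactSupport
        hc.mul_left
    · exact ((hΦcont.comp (hcm j)).mul hdc).integrable_of_hasCompactSupport hdcs.mul_left
    · exact ((hΦcont.comp (hcm j)).mul hψ.continuous).integrable_of_hasCompactSupport hc.mul_left
  have hFi : Integrable fun x => F x i := hF.eval_piLp i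
  have hΦf : Integrable fun x => Φ (f x) * fderiv ℝ ψ x e := by
    refine Integrable.mono' ((hf.norm.mul_const A).add
      ((hdc.norm.integrable_of_hasCompactSupport hdcs.norm).const_mul |Φ 0|))
      ((hΦcont.comp_aestronglyMeasurable hf.1).mul hdc.aestronglyMeasurable)
      (Filter.Eventually.of_forall fun x => ?_)
    have h1 : |Φ (f x)| ≤ |f x| + |Φ 0| := by
      have := hlip (f x) 0
      have := abs_sub_abs_le_abs_sub (Φ (f x)) (Φ 0)
      simp only [sub_zero] at *
      linarith
    simp only [Pi.add_apply, norm_mul, Real.norm_eq_abs]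
    have h2 : |fderiv ℝ ψ x e| ≤ A := hA x
    nlinarith [abs_nonneg (f x), abs_nonneg (fderiv ℝ ψ x e), abs_nonneg (Φ 0)]
  have hΦF : Integrable fun x => Φ' (f x) * F x i * ψ x := by
    refine Integrable.mono' (hFi.norm.mul_const B)
      (((hΦc.comp_aestronglyMeasurable hf.1).mul hFi.1).mul hψ.continuous.aestronglyMeasurable)
      (Filter.Eventually.of_forall fun x => ?_)
    rw [norm_mul, norm_mul]
    refine mul_le_mul ?_ (hB x) (norm_nonneg _) (norm_nonneg _)
    exact mul_le_of_le_one_left (norm_nonneg _) (hΦ1 _)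
  have hlim1 : Tendsto (fun j => ∫ x, Φ (mollify j f x) * fderiv ℝ ψ x e) atTop
      (𝓝 (∫ x, Φ (f x) * fderiv ℝ ψ x e)) := by
    refine tendsto_integral_of_le_enorm_mollify (A := ⟨A, hA0⟩) hf (fun j => ?_) hΦf.1
      (fun j x => ?_) ?_
    · exact ((hΦcont.comp (hcm j)).mul hdc).integrable_of_hasCompactSupport hdcs.mul_left
    · rw [← sub_mul, enorm_mul, mul_comm]
      refine mul_le_mul' ?_ ?_
      · exact enorm_le_coe.2 (hA x)
      · exact (enorm_le_iff_norm_le.2 (hlip _ _)).trans enorm_sub_le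
    · filter_upwards [ae_tendsto_mollify hf.locallyIntegrable] with x hx
      exact ((hΦcont.tendsto _).comp hx).mul_const _
  have hlim2 : Tendsto (fun j => ∫ x, Φ' (mollify j f x) * mollify j F x i * ψ x) atTop
      (𝓝 (∫ x, Φ' (f x) * F x i * ψ x)) := by
    refine tendsto_integral_of_le_enorm_mollify (A := ⟨B, hB0⟩) hF (fun j => ?_) hΦF.1
      (fun j x => ?_) ?_
    · have hci : Continuous fun x => mollify j F x i := by
        have := hcM j
        fun_prop
      exact (((hΦc.comp (hcm j)).mul hci).mul hψ.continuous).integrable_of_hasCompactSupport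
        hc.mul_left
    · have key : ∀ (t : ℝ) (w : Eucl n), ‖Φ' t * w i‖ₑ ≤ ‖w‖ₑ := fun t w => by
        refine enorm_le_iff_norm_le.2 ?_
        rw [norm_mul]
        exact (mul_le_of_le_one_left (norm_nonneg _) (hΦ1 _)).trans (PiLp.norm_apply_le w i)
      rw [← sub_mul, enorm_mul, mul_comm]
      refine mul_le_mul' (enorm_le_coe.2 (hB x)) (enorm_sub_le.trans ?_)
      exact add_le_add (key _ _) (key _ _)
    · filter_upwards [ae_tendsto_mollify hf.locallyIntegrable,
        ae_tendsto_mollify hF.locallyIntegrable] with x hx hX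
      have : Tendsto (fun j => mollify j F x i) atTop (𝓝 (F x i)) :=
        ((PiLp.continuous_apply 2 _ i).tendsto _).comp hX
      exact (((hΦc.tendsto _).comp hx).mul this).mul_const _
  refine tendsto_nhds_unique hlim1 ?_
  simp only [hparts]
  exact hlim2.neg

/-! ### Smooth cutoffs and the product rule -/

theorem exists_smooth_cutoff {n : ℕ} {K Ω : Set (Eucl n)} (hK : IsCompact K) (hΩ : IsOpen Ω)
    (hKΩ : K ⊆ Ω) :
    ∃ χ : Eucl n → ℝ, ContDiff ℝ ∞ χ ∧ HasCompactSupport χ ∧ tsupport χ ⊆ Ω ∧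
      (∀ x ∈ K, χ x = 1) ∧ ∀ x, χ x ∈ Icc (0 : ℝ) 1 := by
  obtain ⟨L, hL, hKL, hLΩ⟩ := exists_compact_between hK hΩ hKΩ
  obtain ⟨f, h1, h0, hI⟩ := exists_contMDiffMap_one_nhds_of_subset_interior
    (modelWithCornersSelf ℝ (Eucl n)) (n := (⊤ : ℕ∞)) hK.isClosed hKL
  have hts : tsupport (f : Eucl n → ℝ) ⊆ L :=
    closure_minimal (fun x hx => by_contra fun hxL => hx (h0 x hxL)) hL.isClosed
  exact ⟨f, f.contMDiff.contDiff, HasCompactSupport.of_support_subset_isCompact hL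
    ((subset_tsupport _).trans hts), hts.trans hLΩ, fun x hx => h1.self_of_nhdsSet x hx, hI⟩

theorem gradient_apply_eq_fderiv {n : ℕ} (f : Eucl n → ℝ) (x : Eucl n) (i : Fin n) :
    gradient f x i = fderiv ℝ f x (EuclideanSpace.single i 1) := by
  have h1 : inner ℝ (gradient f x) (EuclideanSpace.single i (1 : ℝ)) =
      fderiv ℝ f x (EuclideanSpace.single i 1) := by
    rw [gradient, InnerProductSpace.toDual_symm_apply]
  rw [← h1, EuclideanSpace.inner_single_right]
  simp

theorem norm_gradient {n : ℕ} (f : Eucl n → ℝ) (x : Eucl n) :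
    ‖gradient f x‖ = ‖fderiv ℝ f x‖ := by
  simp [gradient]

theorem ContDiff.continuous_gradient {n : ℕ} {f : Eucl n → ℝ} (hf : ContDiff ℝ ∞ f) :
    Continuous (gradient f) :=
  (InnerProductSpace.toDual ℝ (Eucl n)).symm.continuous.comp
    ((hf.of_le (m := 1) (by exact_mod_cast le_top)).continuous_fderiv one_ne_zero)

theorem gradient_eq_zero_of_notMem_tsupport {n : ℕ} {f : Eucl n → ℝ} {x : Eucl n}
    (hx : x ∉ tsupport f) : gradient f x = 0 := by
  have : fderiv ℝ f x = 0 := by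
    by_contra h
    exact hx (support_fderiv_subset ℝ h)
  simp [gradient, this]

theorem MeasureTheory.LocallyIntegrableOn.integrable_smul_of_eq_zero_off {n : ℕ} {V : Type*}
    [NormedAddCommGroup V] [NormedSpace ℝ V] {Ω K : Set (Eucl n)} {v : Eucl n → V}
    (hv : LocallyIntegrableOn v Ω) {c : Eucl n → ℝ} (hc : Continuous c) (hK : IsCompact K)
    (hKΩ : K ⊆ Ω) (h0 : ∀ x, x ∉ K → c x = 0) :
    Integrable fun x => c x • v x := by
  rw [← integrableOn_iff_integrable_of_support_subset (s := K)]
  · exact (hv.integrableOn_compact_subset hKΩ hK).continuousOn_smul hc.continuousOn hK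
  · intro x hx
    by_contra hxK
    exact hx (by simp [h0 x hxK])

theorem MeasureTheory.LocallyIntegrableOn.integrable_smul_vector_of_eq_zero_off {n : ℕ} {V : Type*}
    [NormedAddCommGroup V] [NormedSpace ℝ V] {Ω K : Set (Eucl n)} {v : Eucl n → ℝ}
    (hv : LocallyIntegrableOn v Ω) {c : Eucl n → V} (hc : Continuous c) (hK : IsCompact K)
    (hKΩ : K ⊆ Ω) (h0 : ∀ x, x ∉ K → c x = 0) :
    Integrable fun x => v x • c x := by
  rw [← integrableOn_iff_integrable_of_support_subset (s := K)]
  · exact (hv.integrableOn_compact_subset hKΩ hK).smul_continuousOn hc.continuousOn hK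
  · intro x hx
    by_contra hxK
    exact hx (by simp [h0 x hxK])

theorem MeasureTheory.LocallyIntegrableOn.mono_of_isOpen {n : ℕ} {V W : Type*}
    [NormedAddCommGroup V] [NormedAddCommGroup W] {Ω : Set (Eucl n)} (hΩ : IsOpen Ω)
    {v : Eucl n → V} {w : Eucl n → W} (hv : LocallyIntegrableOn v Ω)
    (hw : AEStronglyMeasurable w (volume.restrict Ω)) (hle : ∀ x, ‖w x‖ ≤ ‖v x‖) :
    LocallyIntegrableOn w Ω := by
  rw [locallyIntegrableOn_iff hΩ.isLocallyClosed]
  exact fun K hKΩ hK => Integrable.mono (hv.integrableOn_compact_subset hKΩ hK) (hw.mono_set hKΩ)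
    (Filter.Eventually.of_forall hle)

namespace IsWeakGradient

variable {n : ℕ} {Ω : Set (Eucl n)} {v : Eucl n → ℝ} {g : Eucl n → Eucl n}

theorem integral_eq (h : IsWeakGradient Ω v g) {ψ : Eucl n → ℝ} (hψ : ContDiff ℝ ∞ ψ)
    (hc : HasCompactSupport ψ) (hs : tsupport ψ ⊆ Ω) (i : Fin n) :
    ∫ x, v x * fderiv ℝ ψ x (EuclideanSpace.single i 1) = - ∫ x, g x i * ψ x := by
  have := h.2.2 ψ hψ hc hs i
  rwa [setIntegral_eq_integral_of_forall_compl_eq_zero,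
    setIntegral_eq_integral_of_forall_compl_eq_zero] at this
  · intro x hx
    rw [image_eq_zero_of_notMem_tsupport fun h => hx (hs h), mul_zero]
  · intro x hx
    rw [← gradient_apply_eq_fderiv, gradient_eq_zero_of_notMem_tsupport fun h => hx (hs h)]
    simp

theorem of_integral_eq (h1 : LocallyIntegrableOn v Ω) (h2 : LocallyIntegrableOn g Ω)
    (h : ∀ ψ : Eucl n → ℝ, ContDiff ℝ ∞ ψ → HasCompactSupport ψ → tsupport ψ ⊆ Ω → ∀ i : Fin n,
      ∫ x, v x * fderiv ℝ ψ x (EuclideanSpace.single i 1) = - ∫ x, g x i * ψ x) :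
    IsWeakGradient Ω v g := by
  refine ⟨h1, h2, fun ψ hψ hc hs i => ?_⟩
  rw [setIntegral_eq_integral_of_forall_compl_eq_zero,
    setIntegral_eq_integral_of_forall_compl_eq_zero]
  · exact h ψ hψ hc hs i
  · intro x hx
    rw [image_eq_zero_of_notMem_tsupport fun h => hx (hs h), mul_zero]
  · intro x hx
    rw [← gradient_apply_eq_fderiv, gradient_eq_zero_of_notMem_tsupport fun h => hx (hs h)]
    simp

theorem mono_set (h : IsWeakGradient Ω v g) {Ω' : Set (Eucl n)} (hsub : Ω' ⊆ Ω) :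
    IsWeakGradient Ω' v g :=
  of_integral_eq (h.1.mono_set hsub) (h.2.1.mono_set hsub)
    fun _ hψ hc hs i => h.integral_eq hψ hc (hs.trans hsub) i

theorem neg (h : IsWeakGradient Ω v g) : IsWeakGradient Ω (fun x => -v x) (fun x => -g x) := by
  refine ⟨h.1.neg, h.2.1.neg, fun ψ hψ hc hs i => ?_⟩
  have := h.2.2 ψ hψ hc hs i
  simp only [neg_mul, integral_neg, PiLp.neg_apply, this]

theorem zero : IsWeakGradient Ω (fun _ => 0) (fun _ => 0) :=
  ⟨locallyIntegrableOn_zero, locallyIntegrableOn_zero, fun ψ _ _ _ i => by simp⟩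

section Cutoff

variable {ζ : Eucl n → ℝ}

theorem integrable_cutoff (h : IsWeakGradient Ω v g) (hζ : ContDiff ℝ ∞ ζ)
    (hc : HasCompactSupport ζ) (hs : tsupport ζ ⊆ Ω) : Integrable fun x => ζ x * v x :=
  h.1.integrable_smul_of_eq_zero_off hζ.continuous hc.isCompact hs
    fun _ => image_eq_zero_of_notMem_tsupport

theorem integrable_gradient_cutoff (h : IsWeakGradient Ω v g) (hζ : ContDiff ℝ ∞ ζ)
    (hc : HasCompactSupport ζ) (hs : tsupport ζ ⊆ Ω) :
    Integrable fun x => ζ x • g x + v x • gradient ζ x :=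
  (h.2.1.integrable_smul_of_eq_zero_off hζ.continuous hc.isCompact hs
    fun _ => image_eq_zero_of_notMem_tsupport).add
  (h.1.integrable_smul_vector_of_eq_zero_off hζ.continuous_gradient hc.isCompact hs
    fun _ => gradient_eq_zero_of_notMem_tsupport)

/-- The product rule for a smooth cutoff function, with extension by zero to the whole space. -/
theorem cutoff (h : IsWeakGradient Ω v g) (hζ : ContDiff ℝ ∞ ζ)
    (hc : HasCompactSupport ζ) (hs : tsupport ζ ⊆ Ω) :
    IsWeakGradient univ (fun x => ζ x * v x) (fun x => ζ x • g x + v x • gradient ζ x) := by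
  refine of_integral_eq ((h.integrable_cutoff hζ hc hs).locallyIntegrable.locallyIntegrableOn _)
    ((h.integrable_gradient_cutoff hζ hc hs).locallyIntegrable.locallyIntegrableOn _)
    fun ψ hψ hψc _ i => ?_
  have hζ1 : ContDiff ℝ 1 ζ := hζ.of_le (by exact_mod_cast le_top)
  have hψ1 : ContDiff ℝ 1 ψ := hψ.of_le (by exact_mod_cast le_top)
  have hg : LocallyIntegrableOn (fun x => g x i) Ω :=
    (EuclideanSpace.proj i : Eucl n →L[ℝ] ℝ).locallyIntegrableOn_comp h.2.1
  have hmain := h.integral_eq (ψ := fun x => ζ x * ψ x) (hζ.mul hψ) hc.mul_right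
    ((tsupport_mul_subset_left).trans hs) i
  have hd : ∀ x, fderiv ℝ (fun x => ζ x * ψ x) x (EuclideanSpace.single i 1) =
      ζ x * gradient ψ x i + ψ x * gradient ζ x i := fun x => by
    rw [fderiv_fun_mul (hζ1.differentiable one_ne_zero x) (hψ1.differentiable one_ne_zero x)]
    simp [gradient_apply_eq_fderiv]
  have hci : ∀ {f : Eucl n → ℝ}, ContDiff ℝ ∞ f → Continuous fun x => gradient f x i :=
    fun hf => (PiLp.continuous_apply 2 _ i).comp hf.continuous_gradient
  have i1 : Integrable fun x => (ζ x * gradient ψ x i) • v x :=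
    h.1.integrable_smul_of_eq_zero_off (hζ.continuous.mul (hci hψ)) hc.isCompact hs
      fun x hx => by rw [image_eq_zero_of_notMem_tsupport hx, zero_mul]
  have i2 : Integrable fun x => (ψ x * gradient ζ x i) • v x :=
    h.1.integrable_smul_of_eq_zero_off (hψ.continuous.mul (hci hζ)) hc.isCompact hs
      fun x hx => by rw [gradient_eq_zero_of_notMem_tsupport hx]; simp
  have i3 : Integrable fun x => (ζ x * ψ x) • g x i :=
    hg.integrable_smul_of_eq_zero_off (hζ.continuous.mul hψ.continuous) hc.isCompact hs
      fun x hx => by rw [image_eq_zero_of_notMem_tsupport hx, zero_mul]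
  have e1 : ∫ x, v x * fderiv ℝ (fun x => ζ x * ψ x) x (EuclideanSpace.single i 1) =
      (∫ x, (ζ x * gradient ψ x i) • v x) + ∫ x, (ψ x * gradient ζ x i) • v x := by
    rw [← integral_add i1 i2]
    refine integral_congr_ae (Filter.Eventually.of_forall fun x => ?_)
    simp only [hd, smul_eq_mul]
    ring
  have e2 : ∫ x, (ζ x • g x + v x • gradient ζ x) i * ψ x =
      (∫ x, (ζ x * ψ x) • g x i) + ∫ x, (ψ x * gradient ζ x i) • v x := by
    rw [← integral_add i3 i2]
    refine integral_congr_ae (Filter.Eventually.of_forall fun x => ?_)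
    simp only [PiLp.add_apply, PiLp.smul_apply, smul_eq_mul]
    ring
  have e3 : ∫ x, ζ x * v x * fderiv ℝ ψ x (EuclideanSpace.single i 1) =
      ∫ x, (ζ x * gradient ψ x i) • v x := by
    refine integral_congr_ae (Filter.Eventually.of_forall fun x => ?_)
    simp only [← gradient_apply_eq_fderiv, smul_eq_mul]
    ring
  have e4 : ∫ x, g x i * (ζ x * ψ x) = ∫ x, (ζ x * ψ x) • g x i := by
    refine integral_congr_ae (Filter.Eventually.of_forall fun x => ?_)
    simp only [smul_eq_mul]
    ring
  rw [e3, e2]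
  rw [e1, e4] at hmain
  linarith

end Cutoff

end IsWeakGradient

/-! ### Chain rule for the positive part -/

theorem hasDerivAt_max_zero_sq (t : ℝ) :
    HasDerivAt (fun t : ℝ => (max t 0) ^ 2) (2 * max t 0) t := by
  rcases lt_trichotomy t 0 with h | rfl | h
  · have : (fun t : ℝ => (max t 0) ^ 2) =ᶠ[nhds t] fun _ => 0 := by
      filter_upwards [Iio_mem_nhds h] with s hs
      simp [max_eq_right (le_of_lt (mem_Iio.1 hs))]
    rw [max_eq_right h.le, mul_zero]
    exact (hasDerivAt_const t (0 : ℝ)).congr_of_eventuallyEq this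
  · rw [hasDerivAt_iff_isLittleO]
    simp only [max_self, mul_zero, sub_zero, smul_zero]
    have h1 : (fun x : ℝ => max x 0 ^ 2 - 0 ^ 2) =O[nhds 0] fun x : ℝ => x ^ 2 := by
      refine Asymptotics.IsBigO.of_bound 1 (Filter.Eventually.of_forall fun x => ?_)
      rcases le_total x 0 with hx | hx
      · simp [max_eq_right hx, sq_nonneg]
      · simp [max_eq_left hx]
    exact h1.trans_isLittleO (Asymptotics.isLittleO_pow_id one_lt_two)
  · have : (fun t : ℝ => (max t 0) ^ 2) =ᶠ[nhds t] fun s => s ^ 2 := by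
      filter_upwards [Ioi_mem_nhds h] with s hs
      simp [max_eq_left (le_of_lt (mem_Ioi.1 hs))]
    rw [max_eq_left h.le]
    simpa using (hasDerivAt_pow 2 t).congr_of_eventuallyEq this

/-- A C¹ regularisation of (t − k)₊ whose slope lies in [0, 1) and is exactly zero for t ≤ k. -/
theorem hasDerivAt_sqrt_max_zero_sq_add {ε : ℝ} (hε : 0 < ε) (k t : ℝ) :
    HasDerivAt (fun t : ℝ => √((max (t - k) 0) ^ 2 + ε ^ 2))
      (max (t - k) 0 / √((max (t - k) 0) ^ 2 + ε ^ 2)) t := by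
  have h1 : HasDerivAt (fun t : ℝ => (max (t - k) 0) ^ 2 + ε ^ 2) (2 * max (t - k) 0) t := by
    have := ((hasDerivAt_max_zero_sq (t - k)).comp t ((hasDerivAt_id t).sub_const k)).add_const
      (ε ^ 2)
    simpa [Function.comp_def] using this
  have h2 := h1.sqrt (by positivity)
  convert! h2 using 1
  have : 0 < √((max (t - k) 0) ^ 2 + ε ^ 2) := Real.sqrt_pos.2 (by positivity)
  field_simp

open Filter Topology in
/-- The chain rule for the positive part, for integrable functions on the whole space. -/
theorem IsWeakGradient.integral_posPart_mul_fderiv {n : ℕ} {f : Eucl n → ℝ}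
    {F : Eucl n → Eucl n} (h : IsWeakGradient univ f F) (hf : Integrable f) (hF : Integrable F)
    (k : ℝ) {ψ : Eucl n → ℝ} (hψ : ContDiff ℝ ∞ ψ) (hc : HasCompactSupport ψ) (i : Fin n) :
    ∫ x, max (f x - k) 0 * fderiv ℝ ψ x (EuclideanSpace.single i 1) =
      - ∫ x, {x | k < f x}.indicator F x i * ψ x := by
  have hψ1 : ContDiff ℝ 1 ψ := hψ.of_le (by exact_mod_cast le_top)
  set e : Eucl n := EuclideanSpace.single i 1
  have hdc : Continuous fun x => fderiv ℝ ψ x e := (hψ1.continuous_fderiv one_ne_zero).clm_apply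
    continuous_const
  have hdcs : HasCompactSupport fun x => fderiv ℝ ψ x e := hc.fderiv_apply ℝ e
  obtain ⟨A, hA⟩ := hdc.bounded_above_of_compact_support hdcs
  obtain ⟨B, hB⟩ := hψ.continuous.bounded_above_of_compact_support hc
  have hFi : Integrable fun x => F x i := hF.eval_piLp i
  let ε : ℕ → ℝ := fun j => 1 / ((j : ℝ) + 1)
  have hε : ∀ j, 0 < ε j := fun j => by positivity
  have hε1 : ∀ j, ε j ≤ 1 := fun j => by
    rw [div_le_one (by positivity)]
    linarith [(Nat.cast_nonneg j : (0 : ℝ) ≤ j)]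
  have hεt : Tendsto ε atTop (𝓝 0) := tendsto_one_div_add_atTop_nhds_zero_nat
  have hpos : ∀ j t, 0 < √((max (t - k) 0) ^ 2 + ε j ^ 2) := fun j t =>
    Real.sqrt_pos.2 (by have := hε j; positivity)
  have hle : ∀ j t, max (t - k) 0 ≤ √((max (t - k) 0) ^ 2 + ε j ^ 2) := fun j t =>
    Real.le_sqrt_of_sq_le (by nlinarith [sq_nonneg (ε j)])
  have hq1 : ∀ j t, |max (t - k) 0 / √((max (t - k) 0) ^ 2 + ε j ^ 2)| ≤ 1 := fun j t => by
    rw [abs_of_nonneg (div_nonneg (le_max_right _ _) (hpos j t).le)]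
    exact div_le_one_of_le₀ (hle j t) (hpos j t).le
  have hqc : ∀ j, Continuous fun t => max (t - k) 0 / √((max (t - k) 0) ^ 2 + ε j ^ 2) :=
    fun j => Continuous.div (by fun_prop) (by fun_prop) fun t => (hpos j t).ne'
  have hΦc : ∀ j, Continuous fun t => √((max (t - k) 0) ^ 2 + ε j ^ 2) := fun j => by fun_prop
  have hsq : ∀ t, Tendsto (fun j => √((max (t - k) 0) ^ 2 + ε j ^ 2)) atTop
      (𝓝 (max (t - k) 0)) := fun t => by
    have h1 : Tendsto (fun j => (max (t - k) 0) ^ 2 + ε j ^ 2) atTop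
        (𝓝 ((max (t - k) 0) ^ 2 + 0 ^ 2)) := (hεt.pow 2).const_add _
    have := h1.sqrt
    rwa [zero_pow two_ne_zero, add_zero, Real.sqrt_sq (le_max_right _ _)] at this
  have hident := fun j => h.integral_comp_mul_fderiv hf hF
    (fun t => hasDerivAt_sqrt_max_zero_sq_add (hε j) k t) (hqc j) (hq1 j) hψ hc i
  have hlim1 : Tendsto (fun j => ∫ x, √((max (f x - k) 0) ^ 2 + ε j ^ 2) * fderiv ℝ ψ x e) atTop
      (𝓝 (∫ x, max (f x - k) 0 * fderiv ℝ ψ x e)) := by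
    refine tendsto_integral_of_dominated_convergence
      (fun x => |f x| * A + (|k| + 1) * ‖fderiv ℝ ψ x e‖) (fun j => ?_) ?_
      (fun j => Eventually.of_forall fun x => ?_) (Eventually.of_forall fun x => ?_)
    · exact ((hΦc j).comp_aestronglyMeasurable hf.1).mul hdc.aestronglyMeasurable
    · exact (hf.norm.mul_const A).add
        ((hdc.norm.integrable_of_hasCompactSupport hdcs.norm).const_mul _)
    · rw [norm_mul, Real.norm_of_nonneg (hpos j _).le]
      have h1 : √((max (f x - k) 0) ^ 2 + ε j ^ 2) ≤ |f x| + |k| + 1 := by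
        refine Real.sqrt_le_iff.2 ⟨by positivity, ?_⟩
        have h2 : max (f x - k) 0 ≤ |f x| + |k| :=
          max_le (by linarith [le_abs_self (f x), neg_abs_le k]) (by positivity)
        have h3 : 0 ≤ max (f x - k) 0 := le_max_right _ _
        nlinarith [hε j, hε1 j]
      have h2 : ‖fderiv ℝ ψ x e‖ ≤ A := hA x
      nlinarith [abs_nonneg (f x), abs_nonneg k, norm_nonneg (fderiv ℝ ψ x e)]
    · exact (hsq _).mul_const _
  have hlim2 : Tendsto (fun j => ∫ x, max (f x - k) 0 / √((max (f x - k) 0) ^ 2 + ε j ^ 2) *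
      F x i * ψ x) atTop (𝓝 (∫ x, {x | k < f x}.indicator F x i * ψ x)) := by
    refine tendsto_integral_of_dominated_convergence
      (fun x => ‖F x i‖ * B) (fun j => ?_) (hFi.norm.mul_const B)
      (fun j => Eventually.of_forall fun x => ?_) (Eventually.of_forall fun x => ?_)
    · exact (((hqc j).comp_aestronglyMeasurable hf.1).mul hFi.1).mul
        hψ.continuous.aestronglyMeasurable
    · rw [norm_mul, norm_mul]
      refine mul_le_mul ?_ (hB x) (norm_nonneg _) (norm_nonneg _)
      exact mul_le_of_le_one_left (norm_nonneg _) (hq1 j _)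
    · refine Tendsto.mul_const _ ?_
      by_cases hx : k < f x
      · have hm : max (f x - k) 0 ≠ 0 := by
          rw [max_eq_left (by linarith)]; linarith [sub_pos.2 hx]
        rw [indicator_of_mem (show x ∈ {x | k < f x} from hx)]
        have := ((tendsto_const_nhds (x := max (f x - k) 0)).div (hsq (f x)) hm).mul_const (F x i)
        rwa [div_self hm, one_mul] at this
      -- The regularised slope is zero on {f ≤ k} for every j, so the limit is the indicator of {f >
      -- k}, and nothing need be known about F on {f = k}.
      · rw [indicator_of_notMem (show x ∉ {x | k < f x} from hx)]
        have : max (f x - k) 0 = 0 := max_eq_right (by linarith)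
        simp [this]
  refine tendsto_nhds_unique hlim1 ?_
  simp only [e, hident]
  exact hlim2.neg

/-- The chain rule for the positive part. -/
theorem IsWeakGradient.posPart {n : ℕ} {Ω : Set (Eucl n)} (hΩ : IsOpen Ω) {v : Eucl n → ℝ}
    {g : Eucl n → Eucl n} (h : IsWeakGradient Ω v g) (k : ℝ) :
    IsWeakGradient Ω (fun x => max (v x - k) 0) ({x | k < v x}.indicator g) := by
  have hvm : AEStronglyMeasurable v (volume.restrict Ω) := h.1.aestronglyMeasurable
  have hgm : AEStronglyMeasurable g (volume.restrict Ω) := h.2.1.aestronglyMeasurable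
  have hset : NullMeasurableSet {x | k < v x} (volume.restrict Ω) :=
    nullMeasurableSet_lt aemeasurable_const hvm.aemeasurable
  refine of_integral_eq ?_ ?_ fun ψ hψ hc hs i => ?_
  · have h1 : LocallyIntegrableOn (fun x => |v x| + |k|) Ω :=
      h.1.norm.add (locallyIntegrableOn_const |k|)
    have h2 : Continuous fun t : ℝ => max (t - k) 0 := by fun_prop
    refine h1.mono_of_isOpen hΩ (h2.comp_aestronglyMeasurable hvm) fun x => ?_
    rw [Real.norm_of_nonneg (le_max_right _ _)]
    exact (max_le (by linarith [le_abs_self (v x), neg_abs_le k]) (by positivity)).trans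
      (le_abs_self _)
  · exact h.2.1.mono_of_isOpen hΩ (hgm.indicator₀ hset)
      fun x => norm_indicator_le_norm_self _ _
  -- With χ = 1 on the support of ψ, the global identity for χv is the required one for v; where ψ ≠
  -- 0, χ is constant nearby and ∇χ drops out.
  obtain ⟨χ, hχ, hχc, hχs, hχ1, -⟩ := exists_smooth_cutoff hc.isCompact hΩ hs
  have key := (h.cutoff hχ hχc hχs).integral_posPart_mul_fderiv
    (h.integrable_cutoff hχ hχc hχs) (h.integrable_gradient_cutoff hχ hχc hχs) k hψ hc i
  have e1 : ∀ x, max (χ x * v x - k) 0 * fderiv ℝ ψ x (EuclideanSpace.single i 1) =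
      max (v x - k) 0 * fderiv ℝ ψ x (EuclideanSpace.single i 1) := fun x => by
    by_cases hx : x ∈ tsupport ψ
    · rw [hχ1 x hx, one_mul]
    · rw [← gradient_apply_eq_fderiv, gradient_eq_zero_of_notMem_tsupport hx]; simp
  have e2 : ∀ x, {x | k < χ x * v x}.indicator
      (fun x => χ x • g x + v x • gradient χ x) x i * ψ x =
      {x | k < v x}.indicator g x i * ψ x := fun x => by
    by_cases hx : ψ x = 0
    · rw [hx, mul_zero, mul_zero]
    have hxs : x ∈ tsupport ψ := subset_tsupport _ hx
    have hg0 : gradient χ x = 0 := by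
      have : χ =ᶠ[nhds x] fun _ => 1 := by
        filter_upwards [hψ.continuous.isOpen_support.mem_nhds hx] with y hy
        exact hχ1 y (subset_tsupport _ hy)
      simp [gradient, this.fderiv_eq]
    by_cases hk : k < v x
    · rw [indicator_of_mem (show x ∈ {x | k < v x} from hk),
        indicator_of_mem (by simpa [hχ1 x hxs] using hk)]
      simp [hχ1 x hxs, hg0]
    · rw [indicator_of_notMem (show x ∉ {x | k < v x} from hk),
        indicator_of_notMem (by simpa [hχ1 x hxs] using hk)]
  simpa only [e1, e2] using key

/-! ### Hölder and Young estimates with a power of the measure -/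

/-- Hölder's inequality for a product of three factors on a finite measure space, in which two of
the exponents may degenerate to zero. -/
theorem lintegral_enorm_mul_rpow_mul_rpow_le {X : Type*} [MeasurableSpace X] {μ : Measure X}
    {σ P Q s t : ℝ} (hσ : 0 < σ) (hP : 0 < P) (hQ : 0 < Q) (hs : 0 ≤ s) (ht : 0 ≤ t)
    (hθ : 0 ≤ 1 - 1 / σ - s / P - t / Q) {f₁ f₂ f₃ : X → ℝ}
    (h₁ : AEStronglyMeasurable f₁ μ) (h₂ : AEStronglyMeasurable f₂ μ)
    (h₃ : AEStronglyMeasurable f₃ μ) :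
    ∫⁻ x, ‖f₁ x‖ₑ * ‖f₂ x‖ₑ ^ s * ‖f₃ x‖ₑ ^ t ∂μ ≤
      eLpNorm f₁ (ENNReal.ofReal σ) μ * eLpNorm f₂ (ENNReal.ofReal P) μ ^ s *
        eLpNorm f₃ (ENNReal.ofReal Q) μ ^ t * μ univ ^ (1 - 1 / σ - s / P - t / Q) := by
  -- The fourth factor is the constant 1; it takes the leftover weight and produces the power of the
  -- total mass.
  have key := ENNReal.lintegral_prod_norm_pow_le (μ := μ) (Finset.univ : Finset (Fin 4))
    (f := ![fun x => ‖f₁ x‖ₑ ^ σ, fun x => ‖f₂ x‖ₑ ^ P, fun x => ‖f₃ x‖ₑ ^ Q, fun _ => 1])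
    (p := ![1 / σ, s / P, t / Q, 1 - 1 / σ - s / P - t / Q])
    (by
      intro i _
      fin_cases i
      · exact h₁.enorm.pow_const _
      · exact h₂.enorm.pow_const _
      · exact h₃.enorm.pow_const _
      · exact aemeasurable_const)
    (by simp only [Fin.sum_univ_four]; simp)
    (by
      intro i _
      fin_cases i
      · exact (one_div_pos.2 hσ).le
      · exact div_nonneg hs hP.le
      · exact div_nonneg ht hQ.le
      · exact hθ)
  have hn : ∀ {f : X → ℝ} {r : ℝ}, 0 < r → eLpNorm f (ENNReal.ofReal r) μ =
      (∫⁻ x, ‖f x‖ₑ ^ r ∂μ) ^ (1 / r) := fun hr => by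
    rw [eLpNorm_eq_lintegral_rpow_enorm_toReal (by simpa using hr) (by simp),
      ENNReal.toReal_ofReal hr.le]
  rw [hn hσ, hn hP, hn hQ, ← ENNReal.rpow_mul, ← ENNReal.rpow_mul, one_div_mul_eq_div,
    one_div_mul_eq_div]
  simp only [Fin.prod_univ_four, Matrix.cons_val, ← ENNReal.rpow_mul, ENNReal.one_rpow, mul_one,
    lintegral_one, mul_one_div_cancel hσ.ne', ENNReal.rpow_one, mul_div_cancel₀ _ hP.ne',
    mul_div_cancel₀ _ hQ.ne'] at key
  exact key

/-- A power r < p is eventually dominated by δX^p. Beyond the threshold X₀ one has L + cX ≤ (1 + c)X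
and X^{p−r} ≥ (1 + c)^r/δ; below it, monotonicity supplies the constant. -/
theorem exists_add_mul_rpow_le {r p : ℝ} (hr : 0 ≤ r) (hrp : r < p) (L c : ℝ≥0) {δ : ℝ}
    (hδ : 0 < δ) : ∃ C : ℝ, 0 < C ∧ ∀ X : ℝ, 0 ≤ X → (L + c * X) ^ r ≤ δ * X ^ p + C := by
  have hs : 0 < p - r := sub_pos.2 hrp
  set B : ℝ := (1 + c : ℝ) ^ r / δ
  have hB : 0 ≤ B := by positivity
  set X₀ : ℝ := max L (B ^ (1 / (p - r)))
  have hX₀ : 0 ≤ X₀ := le_max_of_le_left L.2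
  refine ⟨(L + c * X₀) ^ r + 1, by positivity, fun X hX => ?_⟩
  rcases le_total X X₀ with h | h
  · have : (L + c * X) ^ r ≤ (L + c * X₀) ^ r :=
      Real.rpow_le_rpow (by positivity) (by gcongr) hr
    have : 0 ≤ δ * X ^ p := by positivity
    linarith
  · have h1 : (L : ℝ) ≤ X := (le_max_left _ _).trans h
    have h2 : B ≤ X ^ (p - r) := by
      have := Real.rpow_le_rpow (by positivity) ((le_max_right _ _).trans h) hs.le
      rwa [← Real.rpow_mul hB, one_div_mul_cancel hs.ne', Real.rpow_one] at this
    have h3 : (L + c * X) ^ r ≤ δ * X ^ p := by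
      calc (L + c * X) ^ r ≤ ((1 + c) * X) ^ r :=
            Real.rpow_le_rpow (by positivity) (by linarith) hr
        _ = δ * B * X ^ r := by
            rw [Real.mul_rpow (by positivity) hX, mul_div_cancel₀ _ hδ.ne']
        _ ≤ δ * X ^ (p - r) * X ^ r := by gcongr
        _ = δ * X ^ p := by
            rcases hX.eq_or_lt with rfl | hX'
            · have : p ≠ 0 := by linarith
              rw [Real.zero_rpow this, Real.zero_rpow hs.ne']
              ring
            · rw [mul_assoc, ← Real.rpow_add hX', sub_add_cancel]
    have : 0 ≤ (L + c * X₀) ^ r := by positivity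
    linarith

/-- Hölder's inequality gives M(L + cY)^{s+t} times a power of the mass, and s + t < p makes the
middle factor at most a small multiple of Y^p plus a constant. Since the mass is at most 1, its
power can be lowered to θ, and next to Y^p it can be discarded. -/
theorem exists_lintegral_mul_rpow_mul_rpow_le {σ P Q s t θ p : ℝ} (hσ : 0 < σ) (hP : 0 < P)
    (hQ : 0 < Q) (hs : 0 ≤ s) (ht : 0 ≤ t) (hst : s + t < p) (hθ0 : 0 ≤ θ)
    (hθ : θ ≤ 1 - 1 / σ - s / P - t / Q) (M L c : ℝ≥0) {δ : ℝ} (hδ : 0 < δ) :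
    ∃ C : ℝ, 0 < C ∧ ∀ {X : Type} [MeasurableSpace X] (μ : Measure X), μ univ ≤ 1 →
      ∀ f₁ f₂ f₃ : X → ℝ, AEStronglyMeasurable f₁ μ → AEStronglyMeasurable f₂ μ →
        AEStronglyMeasurable f₃ μ → ∀ Y : ℝ≥0, eLpNorm f₁ (ENNReal.ofReal σ) μ ≤ M →
        eLpNorm f₂ (ENNReal.ofReal P) μ ≤ L + c * Y →
        eLpNorm f₃ (ENNReal.ofReal Q) μ ≤ L + c * Y →
        ∫⁻ x, ‖f₁ x‖ₑ * ‖f₂ x‖ₑ ^ s * ‖f₃ x‖ₑ ^ t ∂μ ≤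
          ENNReal.ofReal (δ * (Y : ℝ) ^ p + C * μ.real univ ^ θ) := by
  obtain ⟨C, hC, hCle⟩ := exists_add_mul_rpow_le (add_nonneg hs ht) hst L c
    (δ := δ / (M + 1)) (by positivity)
  refine ⟨(M + 1) * C, by positivity, fun {X} _ μ hμ f₁ f₂ f₃ h₁ h₂ h₃ Y hf₁ hf₂ hf₃ => ?_⟩
  refine (lintegral_enorm_mul_rpow_mul_rpow_le hσ hP hQ hs ht (hθ0.trans hθ) h₁ h₂ h₃).trans ?_
  have hμt : μ univ ≠ ⊤ := ne_top_of_le_ne_top ENNReal.one_ne_top hμ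
  set τ : ℝ := μ.real univ
  have hτ : μ univ = ENNReal.ofReal τ := (ENNReal.ofReal_toReal hμt).symm
  have hτ0 : 0 ≤ τ := measureReal_nonneg
  have hτ1 : τ ≤ 1 := ENNReal.toReal_le_of_le_ofReal zero_le_one (by simpa using hμ)
  have hLY : (L + c * Y : ℝ≥0∞) = ENNReal.ofReal (L + c * Y) := by
    rw [ENNReal.ofReal_add (by positivity) (by positivity), ENNReal.ofReal_mul (by positivity)]
    simp
  have hM : (M : ℝ≥0∞) ≤ ENNReal.ofReal (M + 1) := by
    rw [← ENNReal.ofReal_coe_nnreal]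
    exact ENNReal.ofReal_le_ofReal (by linarith)
  have hB : 0 ≤ (L + c * Y : ℝ) := by positivity
  calc _ ≤ ENNReal.ofReal (M + 1) * ENNReal.ofReal (L + c * Y) ^ s *
        ENNReal.ofReal (L + c * Y) ^ t * ENNReal.ofReal τ ^ (1 - 1 / σ - s / P - t / Q) := by
        rw [← hLY, ← hτ]
        gcongr
        exact hf₁.trans hM
    _ = ENNReal.ofReal ((M + 1) * (L + c * Y) ^ s * (L + c * Y) ^ t *
        τ ^ (1 - 1 / σ - s / P - t / Q)) := by
        rw [ENNReal.ofReal_rpow_of_nonneg hB hs, ENNReal.ofReal_rpow_of_nonneg hB ht,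
          ENNReal.ofReal_rpow_of_nonneg hτ0 (hθ0.trans hθ), ← ENNReal.ofReal_mul (by positivity),
          ← ENNReal.ofReal_mul (by positivity), ← ENNReal.ofReal_mul (by positivity)]
    _ ≤ _ := by
        refine ENNReal.ofReal_le_ofReal ?_
        -- Because 0^0 = 1, the case τ = 0 needs a check: if the Hölder exponent is zero, then so is
        -- θ.
        have hτθ : τ ^ (1 - 1 / σ - s / P - t / Q) ≤ τ ^ θ :=
          Real.rpow_le_rpow_of_exponent_ge_of_imp hτ0 hτ1 hθ (fun h1 h2 => by
            rw [h2] at hθ; exact le_antisymm hθ hθ0)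
        have hτθ1 : τ ^ θ ≤ 1 := Real.rpow_le_one hτ0 hτ1 hθ0
        have hτθ0 : 0 ≤ τ ^ θ := by positivity
        have hY := hCle Y Y.2
        rw [Real.rpow_add_of_nonneg hB hs ht] at hY
        have hYp : 0 ≤ δ * (Y : ℝ) ^ p := by positivity
        calc _ ≤ (M + 1) * ((L + c * Y) ^ s * (L + c * Y) ^ t) * τ ^ θ := by
              rw [mul_assoc (_ + _ : ℝ)]
              gcongr
          _ ≤ (M + 1) * (δ / (M + 1) * (Y : ℝ) ^ p + C) * τ ^ θ := by gcongr
          _ = δ * (Y : ℝ) ^ p * τ ^ θ + (M + 1) * C * τ ^ θ := by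
              field_simp
          _ ≤ _ := by
              exact add_le_add_left (mul_le_of_le_one_right hYp hτθ1) _

/-! ### Measurability of superpositions -/

/-- A superposition of a Carathéodory function with a measurable function is measurable. -/
theorem aemeasurable_caratheodory_comp {X Z : Type*} [MeasurableSpace X] {μ : Measure X}
    [TopologicalSpace Z] [TopologicalSpace.PseudoMetrizableSpace Z] [MeasurableSpace Z]
    [BorelSpace Z] {G : X → Z → ℝ} (hG : ∀ z, AEMeasurable (fun x => G x z) μ)
    (hGc : ∀ᵐ x ∂μ, Continuous (G x)) {z : X → Z} (hz : AEStronglyMeasurable z μ) :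
    AEMeasurable (fun x => G x (z x)) μ := by
  classical
  have hs := hz.stronglyMeasurable_mk
  -- For a simple function the superposition is a finite sum over its level sets; continuity of G(x,
  -- ·) then passes to the limit.
  have h1 : ∀ j, AEMeasurable (fun x => G x (hs.approx j x)) μ := fun j => by
    have : (fun x => G x (hs.approx j x)) = fun x => ∑ c ∈ (hs.approx j).range,
        ((hs.approx j) ⁻¹' {c}).indicator (fun x => G x c) x := by
      funext x
      rw [Finset.sum_eq_single (hs.approx j x)]
      · simp
      · intro c _ hc
        exact indicator_of_notMem (fun h => hc (by simpa using h.symm)) _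
      · intro h
        exact absurd (SimpleFunc.mem_range_self _ x) h
    rw [this]
    exact Finset.aemeasurable_fun_sum _ fun c _ =>
      (hG c).indicator ((hs.approx j).measurableSet_preimage _)
  have h2 : AEMeasurable (fun x => G x (hz.mk z x)) μ := by
    refine aemeasurable_of_tendsto_metrizable_ae Filter.atTop h1 ?_
    filter_upwards [hGc] with x hx
    exact (hx.tendsto _).comp (hs.tendsto_approx x)
  refine h2.congr ?_
  filter_upwards [hz.ae_eq_mk] with x hx
  rw [hx]

/-! ### Radial cutoffs and pointwise convexity inequalities -/

theorem exists_abs_deriv_smoothTransition_le :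
    ∃ C : ℝ, 0 < C ∧ ∀ t, |deriv Real.smoothTransition t| ≤ C := by
  have hc : Continuous (deriv Real.smoothTransition) :=
    (Real.smoothTransition.contDiff (n := 1)).continuous_deriv le_rfl
  obtain ⟨C, hC⟩ := (isCompact_Icc (a := (0 : ℝ)) (b := 1)).exists_bound_of_continuousOn
    hc.continuousOn
  refine ⟨|C| + 1, by positivity, fun t => ?_⟩
  by_cases ht : t ∈ Icc (0 : ℝ) 1
  · exact (hC t ht).trans (by linarith [le_abs_self C])
  · have : deriv Real.smoothTransition t = 0 := by
      rw [mem_Icc, not_and_or, not_le, not_le] at ht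
      rcases ht with ht | ht
      · have : Real.smoothTransition =ᶠ[nhds t] fun _ => 0 := by
          filter_upwards [Iio_mem_nhds ht] with s hs
          exact Real.smoothTransition.zero_of_nonpos (mem_Iio.1 hs).le
        simp [this.deriv_eq]
      · have : Real.smoothTransition =ᶠ[nhds t] fun _ => 1 := by
          filter_upwards [Ioi_mem_nhds ht] with s hs
          exact Real.smoothTransition.one_of_one_le (mem_Ioi.1 hs).le
        simp [this.deriv_eq]
    rw [this, abs_zero]
    positivity

/-- Smooth cutoff functions between concentric balls with the optimal gradient bound. -/
theorem exists_radial_cutoff : ∃ C : ℝ, 0 < C ∧ ∀ {n : ℕ} (x₀ : Eucl n) {ρ R : ℝ}, 0 < ρ → ρ < R →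
    ∃ η : Eucl n → ℝ, ContDiff ℝ ∞ η ∧ (∀ x, η x ∈ Icc (0 : ℝ) 1) ∧
      (∀ x ∈ Metric.ball x₀ ρ, η x = 1) ∧ (∀ x, x ∉ Metric.ball x₀ R → η x = 0) ∧
      ∀ x, ‖gradient η x‖ ≤ C / (R - ρ) := by
  obtain ⟨C, hC, hCle⟩ := exists_abs_deriv_smoothTransition_le
  refine ⟨2 * C, by positivity, fun {n} x₀ ρ R hρ hρR => ?_⟩
  have hR : 0 < R := hρ.trans hρR
  have hd : 0 < R ^ 2 - ρ ^ 2 := by nlinarith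
  -- The squared norm keeps the profile smooth at the centre. The price is the factor 2R/(R² − ϱ²),
  -- which is at most 2/(R − ϱ).
  have hin : ContDiff ℝ ∞ fun x : Eucl n => (R ^ 2 - ‖x - x₀‖ ^ 2) / (R ^ 2 - ρ ^ 2) :=
    (contDiff_const.sub ((contDiff_id.sub contDiff_const).norm_sq ℝ)).div_const _
  have hη : ContDiff ℝ ∞ fun x : Eucl n =>
      Real.smoothTransition ((R ^ 2 - ‖x - x₀‖ ^ 2) / (R ^ 2 - ρ ^ 2)) :=
    Real.smoothTransition.contDiff.comp hin
  have h0 : ∀ x : Eucl n, x ∉ Metric.ball x₀ R →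
      Real.smoothTransition ((R ^ 2 - ‖x - x₀‖ ^ 2) / (R ^ 2 - ρ ^ 2)) = 0 := fun x hx => by
    refine Real.smoothTransition.zero_of_nonpos (div_nonpos_of_nonpos_of_nonneg ?_ hd.le)
    rw [Metric.mem_ball, dist_eq_norm, not_lt] at hx
    nlinarith
  refine ⟨_, hη, fun x => ⟨Real.smoothTransition.nonneg _, Real.smoothTransition.le_one _⟩,
    fun x hx => ?_, h0, fun x => ?_⟩
  · refine Real.smoothTransition.one_of_one_le ((one_le_div hd).2 ?_)
    rw [Metric.mem_ball, dist_eq_norm] at hx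
    nlinarith [norm_nonneg (x - x₀)]
  have hpos : 0 ≤ 2 * C / (R - ρ) := div_nonneg (by positivity) (sub_pos.2 hρR).le
  by_cases hx : x ∈ Metric.closedBall x₀ R
  · have hderiv : HasFDerivAt (fun x : Eucl n => (R ^ 2 - ‖x - x₀‖ ^ 2) / (R ^ 2 - ρ ^ 2))
        ((R ^ 2 - ρ ^ 2)⁻¹ • -((2 : ℝ) • innerSL ℝ (x - x₀))) x := by
      have h1 := (((hasFDerivAt_id x).sub_const x₀).norm_sq.const_sub (R ^ 2)).mul_const
        (R ^ 2 - ρ ^ 2)⁻¹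
      have e : (2 : ℝ) • innerSL ℝ (x - x₀) = 2 • innerSL ℝ (x - x₀) := by
        ext y
        simp
      rw [e]
      simpa [div_eq_mul_inv] using! h1
    have h2 := ((Real.smoothTransition.contDiff (n := 1)).differentiable one_ne_zero
      ((R ^ 2 - ‖x - x₀‖ ^ 2) / (R ^ 2 - ρ ^ 2))).hasDerivAt.comp_hasFDerivAt x hderiv
    have h2' := h2.fderiv
    rw [Function.comp_def] at h2'
    rw [norm_gradient, h2', norm_smul, norm_smul, norm_neg,
      Real.norm_eq_abs, norm_inv, Real.norm_of_nonneg hd.le]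
    have h3 : ‖(2 : ℝ) • innerSL ℝ (x - x₀)‖ ≤ 2 * R := by
      rw [norm_smul, innerSL_apply_norm]
      rw [Metric.mem_closedBall, dist_eq_norm] at hx
      simpa using hx
    calc _ ≤ C * ((R ^ 2 - ρ ^ 2)⁻¹ * (2 * R)) := by
          gcongr
          exact hCle _
      _ ≤ 2 * C / (R - ρ) := by
          have : R ^ 2 - ρ ^ 2 = (R - ρ) * (R + ρ) := by ring
          have h4 : 0 < R - ρ := sub_pos.2 hρR
          have h5 : R / (R + ρ) ≤ 1 := (div_le_one (by positivity)).2 (by linarith)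
          rw [this]
          calc C * (((R - ρ) * (R + ρ))⁻¹ * (2 * R)) = 2 * C / (R - ρ) * (R / (R + ρ)) := by
                field_simp
            _ ≤ 2 * C / (R - ρ) * 1 := by gcongr
            _ = _ := mul_one _
  · rw [gradient_eq_zero_of_notMem_tsupport, norm_zero]
    · exact hpos
    · refine fun h => hx (closure_minimal (fun y hy => ?_) Metric.isClosed_closedBall h)
      by_contra hyR
      exact hy (h0 y fun h => hyR (Metric.ball_subset_closedBall h))

theorem add_rpow_le_two_rpow_mul {p x y : ℝ} (hp : 0 ≤ p) (hx : 0 ≤ x) (hy : 0 ≤ y) :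
    (x + y) ^ p ≤ 2 ^ p * (x ^ p + y ^ p) := by
  have h1 : (x + y) ^ p ≤ (2 * max x y) ^ p :=
    Real.rpow_le_rpow (by positivity) (by linarith [le_max_left x y, le_max_right x y]) hp
  rw [Real.mul_rpow two_pos.le (le_max_of_le_left hx)] at h1
  refine h1.trans (mul_le_mul_of_nonneg_left ?_ (by positivity))
  have h2 := Real.rpow_nonneg hx p
  have h3 := Real.rpow_nonneg hy p
  rcases max_cases x y with ⟨h, -⟩ | ⟨h, -⟩ <;> rw [h] <;> linarith

section Pointwise

variable {V : Type*} [NormedAddCommGroup V] [NormedSpace ℝ V] {p τ : ℝ} {N : ℕ}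

/-- For τ > 0 the vector is (1 − τ^N)g + τ^N(−(N/τ)b), so convexity of t^p applies; the second term
carries τ^{N−p} ≤ 1 because N ≥ p. The coefficient 1 − τ^N in front of ‖g‖^p is exact, and this is
what leaves τ^N‖g‖^p on the good side of the energy comparison. -/
theorem norm_sub_cutoff_rpow_le (hp : 1 < p) (hN : p ≤ N) (hτ : τ ∈ Icc (0 : ℝ) 1) (g b : V) :
    ‖g - (τ ^ N • g + (N * τ ^ (N - 1)) • b)‖ ^ p ≤
      (1 - τ ^ N) * ‖g‖ ^ p + (N : ℝ) ^ p * ‖b‖ ^ p := by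
  have hN1 : 1 < N := by exact_mod_cast hp.trans_le hN
  have hp0 : 0 < p := by linarith
  rcases hτ.1.eq_or_lt with h0 | h0
  · rw [← h0, zero_pow (by omega), zero_pow (by omega)]
    simp only [mul_zero, zero_smul, add_zero, sub_zero, one_mul]
    have : 0 ≤ (N : ℝ) ^ p * ‖b‖ ^ p := by positivity
    linarith
  have hτN : τ ^ N ≤ 1 := pow_le_one₀ hτ.1 hτ.2
  have hτN0 : 0 ≤ τ ^ N := by positivity
  have e : g - (τ ^ N • g + (N * τ ^ (N - 1)) • b) =
      (1 - τ ^ N) • g - τ ^ N • ((N / τ) • b) := by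
    have : (N : ℝ) * τ ^ (N - 1) = τ ^ N * (N / τ) := by
      rw [← pow_sub_one_mul (by omega : N ≠ 0) τ]
      field_simp
    rw [this, smul_smul, sub_smul, one_smul]
    abel
  have h1 : ‖g - (τ ^ N • g + (N * τ ^ (N - 1)) • b)‖ ≤
      (1 - τ ^ N) * ‖g‖ + τ ^ N * (N / τ * ‖b‖) := by
    rw [e]
    refine (norm_sub_le _ _).trans (le_of_eq ?_)
    rw [norm_smul, norm_smul, norm_smul, Real.norm_of_nonneg (by linarith),
      Real.norm_of_nonneg hτN0, Real.norm_of_nonneg (by positivity)]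
  have h2 := (convexOn_rpow hp.le).2 (x := ‖g‖) (y := N / τ * ‖b‖) (norm_nonneg g)
    (by rw [mem_Ici]; positivity) (sub_nonneg.2 hτN) hτN0 (by ring)
  simp only [smul_eq_mul] at h2
  refine (Real.rpow_le_rpow (norm_nonneg _) h1 hp0.le).trans (h2.trans ?_)
  refine add_le_add_right ?_ _
  rw [Real.mul_rpow (by positivity) (norm_nonneg _), Real.div_rpow (by positivity) h0.le,
    ← mul_assoc]
  refine mul_le_mul_of_nonneg_right ?_ (by positivity)
  have h3 : τ ^ N ≤ τ ^ p := by
    rw [← Real.rpow_natCast]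
    exact Real.rpow_le_rpow_of_exponent_ge h0 hτ.2 hN
  have h4 : 0 < τ ^ p := by positivity
  rw [mul_div_assoc', div_le_iff₀ h4, mul_comm]
  gcongr

/-- The weight τ^N is kept, through τ^{Np} ≤ τ^N, so that the gradient term can later be absorbed by
the same weighted integral. -/
theorem norm_cutoff_rpow_le (hp : 1 < p) (hτ : τ ∈ Icc (0 : ℝ) 1) (g b : V) :
    ‖τ ^ N • g + (N * τ ^ (N - 1)) • b‖ ^ p ≤
      2 ^ p * (τ ^ N * ‖g‖ ^ p + (N : ℝ) ^ p * ‖b‖ ^ p) := by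
  have hp0 : 0 < p := by linarith
  have h0 := hτ.1
  have hτN : τ ^ N ≤ 1 := pow_le_one₀ hτ.1 hτ.2
  have hτN0 : 0 ≤ τ ^ N := by positivity
  have hτN1 : τ ^ (N - 1) ≤ 1 := pow_le_one₀ hτ.1 hτ.2
  have h1 : ‖τ ^ N • g + (N * τ ^ (N - 1)) • b‖ ≤ τ ^ N * ‖g‖ + N * ‖b‖ := by
    refine (norm_add_le _ _).trans ?_
    rw [norm_smul, norm_smul, Real.norm_of_nonneg hτN0, Real.norm_of_nonneg (by positivity)]
    gcongr
    exact mul_le_of_le_one_right (by positivity) hτN1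
  refine (Real.rpow_le_rpow (norm_nonneg _) h1 hp0.le).trans
    ((add_rpow_le_two_rpow_mul hp0.le (by positivity) (by positivity)).trans ?_)
  rw [Real.mul_rpow hτN0 (norm_nonneg _), Real.mul_rpow (by positivity) (norm_nonneg _)]
  gcongr
  exact Real.rpow_le_self_of_le_one hτN0 hτN hp.le

end Pointwise

/-! ### Comparison of energies under a variation of one component -/

/-- The bound on the variation of the lower order term of the energy that the structure condition
gives for a variation of one component of `u` by `f`, with gradient `F`. -/
noncomputable def variationBound {n m : ℕ} (q₁ q₂ α β : ℝ) (a b : Eucl n → ℝ) (u : Eucl n → Eucl m)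
    (Du : Eucl n → GradSpace n m) (f : Eucl n → ℝ) (F : Eucl n → Eucl n) (x : Eucl n) : ℝ :=
  a x * |f x| ^ α * (2 * ‖Du x‖ + ‖F x‖ + 1) ^ q₁ +
    b x * (2 * ‖u x‖ + |f x| + 1) ^ q₂ * ‖F x‖ ^ β

theorem MemW1p.neg {n : ℕ} {Ω : Set (Eucl n)} {p : ℝ} {v : Eucl n → ℝ} {g : Eucl n → Eucl n}
    (h : MemW1p Ω p v g) : MemW1p Ω p (fun x => -v x) (fun x => -g x) :=
  ⟨h.1.neg, h.2.1.neg, h.2.2.neg⟩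

theorem MemW1pVec.memLp {n m : ℕ} {Ω : Set (Eucl n)} {p : ℝ} {u : Eucl n → Eucl m}
    {Du : Eucl n → GradSpace n m} (h : MemW1pVec Ω p u Du) :
    MemLp u (ENNReal.ofReal p) (volume.restrict Ω) ∧
      MemLp Du (ENNReal.ofReal p) (volume.restrict Ω) :=
  ⟨MemLp.of_eval_piLp fun i => (h i).1, MemLp.of_eval_piLp fun i => (h i).2.1⟩

theorem MeasureTheory.MemLp.integrable_norm_rpow_ofReal {X V : Type*} [MeasurableSpace X]
    {μ : Measure X} [NormedAddCommGroup V] {p : ℝ} (hp : 0 < p) {f : X → V}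
    (hf : MemLp f (ENNReal.ofReal p) μ) : Integrable (fun x => ‖f x‖ ^ p) μ := by
  have := hf.integrable_norm_rpow (by simpa using hp) (by simp)
  rwa [ENNReal.toReal_ofReal hp.le] at this

theorem memW1pVec_single {n m : ℕ} {Ω : Set (Eucl n)} {p : ℝ} {f : Eucl n → ℝ}
    {F : Eucl n → Eucl n} (h : MemW1p Ω p f F) (i : Fin m) :
    MemW1pVec Ω p (fun x => EuclideanSpace.single i (f x))
      (fun x => PiLp.single 2 i (F x)) := by
  intro j
  by_cases hj : j = i
  · subst hj
    simpa using h
  · simp only [PiLp.single_apply, if_neg hj]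
    exact ⟨MemLp.zero', MemLp.zero', IsWeakGradient.zero⟩

/-- The competitor is u − f e_i. In the difference of the energies only the i-th p-term and G
survive, and the growth condition bounds the change of G. -/
theorem IsLocalMinimizer.setIntegral_rpow_le {n m : ℕ} {Ω : Set (Eucl n)} {p : ℝ} (hp : 0 < p)
    {q₁ q₂ α β σ₁ σ₂ : ℝ} (hq₁ : 0 ≤ q₁) (hq₂ : 0 ≤ q₂)
    {G : Eucl n → Eucl m → GradSpace n m → ℝ} {a b : Eucl n → ℝ}
    (hG : StructureCond Ω q₁ q₂ α β σ₁ σ₂ G a b) {u : Eucl n → Eucl m}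
    {Du : Eucl n → GradSpace n m} (hu : IsLocalMinimizer Ω p G u Du) (i : Fin m)
    {K : Set (Eucl n)} (hK : IsCompact K) (hKΩ : K ⊆ Ω) {f : Eucl n → ℝ} {F : Eucl n → Eucl n}
    (hf : MemW1p Ω p f F) (hf0 : ∀ x, x ∉ K → f x = 0)
    (hE : IntegrableOn (variationBound q₁ q₂ α β a b u Du f F) K) :
    ∫ x in K, ‖Du x i‖ ^ p ≤ (∫ x in K, ‖Du x i - F x‖ ^ p) +
      ∫ x in K, variationBound q₁ q₂ α β a b u Du f F x := by
  obtain ⟨huW, hfin, hmin⟩ := hu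
  set φ : Eucl n → Eucl m := fun x => EuclideanSpace.single i (-f x)
  set Dφ : Eucl n → GradSpace n m := fun x => PiLp.single 2 i (-F x)
  have hφW : MemW1pVec Ω p φ Dφ := memW1pVec_single hf.neg i
  have hφn : ∀ x, ‖φ x‖ = |f x| := fun x => by simp [φ]
  have hDφn : ∀ x, ‖Dφ x‖ = ‖F x‖ := fun x => by simp [Dφ]
  have hle : volume.restrict K ≤ volume.restrict Ω := Measure.restrict_mono hKΩ le_rfl
  have hac : (volume.restrict K).AbsolutelyContinuous (volume.restrict Ω) := hle.absolutelyContinuous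
  obtain ⟨hum, hDum⟩ := huW.memLp
  obtain ⟨hφm, hDφm⟩ := hφW.memLp
  have hmeas : ∀ {s : Eucl n → Eucl m} {ξ : Eucl n → GradSpace n m},
      AEStronglyMeasurable s (volume.restrict Ω) → AEStronglyMeasurable ξ (volume.restrict Ω) →
      AEStronglyMeasurable (fun x => G x (s x) (ξ x)) (volume.restrict K) := fun hs hξ =>
    ((aemeasurable_caratheodory_comp (G := fun x (z : Eucl m × GradSpace n m) => G x z.1 z.2)
      (fun z => hG.caratheodory.1 z.1 z.2) hG.caratheodory.2 (hs.prodMk hξ)).mono_ac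
        hac).aestronglyMeasurable
  have hdiff : ∀ᵐ x ∂(volume.restrict K), |G x ((u + φ) x) ((Du + Dφ) x) - G x (u x) (Du x)| ≤
      variationBound q₁ q₂ α β a b u Du f F x := by
    filter_upwards [hac.ae_le hG.growth, hac.ae_le hG.a_nonneg, hac.ae_le hG.b_nonneg]
      with x hx ha hb
    refine (hx _ _ _ _).trans ?_
    simp only [Pi.add_apply, add_sub_cancel_left, hφn, hDφn]
    have h1 : ‖Du x + Dφ x‖ + ‖Du x‖ + 1 ≤ 2 * ‖Du x‖ + ‖F x‖ + 1 := by
      linarith [(norm_add_le (Du x) (Dφ x)).trans_eq (by rw [hDφn])]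
    have h2 : ‖u x + φ x‖ + ‖u x‖ + 1 ≤ 2 * ‖u x‖ + |f x| + 1 := by
      linarith [(norm_add_le (u x) (φ x)).trans_eq (by rw [hφn])]
    exact add_le_add
      (mul_le_mul_of_nonneg_left (Real.rpow_le_rpow (by positivity) h1 hq₁) (by positivity))
      (mul_le_mul_of_nonneg_right
        (mul_le_mul_of_nonneg_left (Real.rpow_le_rpow (by positivity) h2 hq₂) hb) (by positivity))
  have hint : IntegrableOn (fun x => G x ((u + φ) x) ((Du + Dφ) x) - G x (u x) (Du x)) K :=
    Integrable.mono' hE ((hmeas (hum.1.add hφm.1) (hDum.1.add hDφm.1)).sub (hmeas hum.1 hDum.1))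
      hdiff
  have hi1 : IntegrableOn (fun x => ‖Du x i‖ ^ p) K :=
    ((huW i).2.1.mono_measure hle).integrable_norm_rpow_ofReal hp
  have hi2 : IntegrableOn (fun x => ‖Du x i - F x‖ ^ p) K :=
    (((huW i).2.1.sub hf.2.1).mono_measure hle).integrable_norm_rpow_ofReal hp
  have hdens : ∀ x, energyDensity p G (u + φ) (Du + Dφ) x = energyDensity p G u Du x +
      (‖Du x i - F x‖ ^ p - ‖Du x i‖ ^ p) +
        (G x ((u + φ) x) ((Du + Dφ) x) - G x (u x) (Du x)) := fun x => by
    have h1 : ∀ j, j ≠ i → ‖(Du + Dφ) x j‖ ^ p = ‖Du x j‖ ^ p := fun j hj => by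
      simp [Dφ, hj]
    have h2 : (Du + Dφ) x i = Du x i - F x := by simp [Dφ, sub_eq_add_neg]
    unfold energyDensity
    rw [← Finset.add_sum_erase _ _ (Finset.mem_univ i),
      ← Finset.add_sum_erase _ (fun j => ‖Du x j‖ ^ p) (Finset.mem_univ i), h2,
      Finset.sum_congr rfl fun j hj => h1 j (Finset.ne_of_mem_erase hj)]
    ring
  have hd0 := hfin K hK hKΩ
  have hi3 : IntegrableOn (fun x => ‖Du x i - F x‖ ^ p - ‖Du x i‖ ^ p) K := hi2.sub hi1
  have hd2 : IntegrableOn (fun x => energyDensity p G u Du x +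
      (‖Du x i - F x‖ ^ p - ‖Du x i‖ ^ p)) K := hd0.add hi3
  -- Minimality may only be tested against competitors of finite energy; here finiteness comes from
  -- the integrable bound on the change of G.
  have hd1 : IntegrableOn (energyDensity p G (u + φ) (Du + Dφ)) K := by
    rw [show energyDensity p G (u + φ) (Du + Dφ) = _ from funext hdens]
    exact hd2.add hint
  have hm := hmin K hK hKΩ φ Dφ hφW (fun x hx => by simp [φ, hf0 x hx]) hd1
  unfold energy at hm
  simp only [hdens] at hm
  rw [integral_add hd2 hint, integral_add hd0 hi3, integral_sub hi2 hi1] at hm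
  have hGE := integral_mono_ae hint hE (hdiff.mono fun x hx => (le_abs_self _).trans hx)
  linarith

/-! ### Exponents and the lower order terms -/

theorem sobolevExp_gt {n : ℕ} {p : ℝ} (hp1 : 1 < p) (hpn : p < n) : p < sobolevExp n p := by
  have h : 0 < (n : ℝ) - p := sub_pos.2 hpn
  rw [sobolevExp, lt_div_iff₀ h]
  nlinarith

namespace ExponentCond

variable {n : ℕ} {p q₁ q₂ α β σ₁ σ₂ : ℝ}

/-- The lower bound imposed on σ₁ is nonnegative: its denominator is p*(p − q₁) − αp, and p − q₁ > α
while p* > p. -/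
theorem σ₁_pos (h : ExponentCond n p q₁ q₂ α β σ₁ σ₂) (hp1 : 1 < p) (hpn : p < n) : 0 < σ₁ := by
  have hs := sobolevExp_gt hp1 hpn
  have hα := h.α_lt.trans_le (min_le_right _ _)
  have h1 := h.α_pos
  have h2 := h.q₁_nonneg
  refine lt_of_le_of_lt (div_nonneg (by nlinarith) ?_) h.σ₁_gt
  nlinarith [mul_pos h1 (sub_pos.2 hs)]

theorem σ₂_pos (h : ExponentCond n p q₁ q₂ α β σ₁ σ₂) (hp1 : 1 < p) (hpn : p < n) : 0 < σ₂ := by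
  have hs := sobolevExp_gt hp1 hpn
  have hβ := h.β_lt.trans_le (min_le_right _ _)
  have h1 := h.β_pos
  have h2 := h.q₂_nonneg
  refine lt_of_le_of_lt (div_nonneg (by nlinarith) ?_) h.σ₂_gt
  nlinarith [mul_nonneg h2 (sub_pos.2 hs).le]

end ExponentCond

theorem eLpNorm_two_mul_add_add_one_le {X : Type*} [MeasurableSpace X] {μ : Measure X}
    (hμ : μ univ ≤ 1) {P : ℝ} (hP : 1 ≤ P) {f g : X → ℝ} (hf : AEStronglyMeasurable f μ)
    (hg : AEStronglyMeasurable g μ) :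
    eLpNorm (fun x => 2 * f x + g x + 1) (ENNReal.ofReal P) μ ≤
      2 * eLpNorm f (ENNReal.ofReal P) μ + eLpNorm g (ENNReal.ofReal P) μ + 1 := by
  have hP0 : 0 < P := zero_lt_one.trans_le hP
  have hP' : 1 ≤ ENNReal.ofReal P := by simpa using hP
  have h1 : AEStronglyMeasurable (fun x => 2 * f x) μ := hf.const_mul 2
  refine (eLpNorm_add_le (h1.add hg) aestronglyMeasurable_const hP').trans
    (add_le_add ((eLpNorm_add_le h1 hg hP').trans (add_le_add ?_ le_rfl)) ?_)
  · refine (eLpNorm_const_smul (2 : ℝ) f _ μ).le.trans (le_of_eq ?_)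
    congr 1
    rw [Real.enorm_eq_ofReal two_pos.le, ENNReal.ofReal_ofNat]
  · rw [eLpNorm_const' _ (by simpa using hP0) (by simp)]
    simpa using ENNReal.rpow_le_one hμ (by positivity)

/-- The lower order terms in the energy inequality are controlled by a small multiple of the
gradient of the variation and a power of the measure of its support. -/
theorem exists_lintegral_variationBound_le {n m : ℕ} {p : ℝ} (hp1 : 1 < p) (hpn : p < n)
    {q₁ q₂ α β σ₁ σ₂ : ℝ} (he : ExponentCond n p q₁ q₂ α β σ₁ σ₂) {ε : ℝ} (hε : 0 < ε)
    (h₁ : q₁ / p + α / sobolevExp n p + 1 / σ₁ + ε ≤ p / n)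
    (h₂ : β / p + q₂ / sobolevExp n p + 1 / σ₂ + ε ≤ p / n) (M M' S : ℝ≥0) {δ : ℝ} (hδ : 0 < δ) :
    ∃ C : ℝ, 0 < C ∧ ∀ μ : Measure (Eucl n), μ univ ≤ 1 →
      ∀ (a b : Eucl n → ℝ) (u : Eucl n → Eucl m) (Du : Eucl n → GradSpace n m) (f : Eucl n → ℝ)
        (F : Eucl n → Eucl n) (Y : ℝ≥0), AEStronglyMeasurable a μ → AEStronglyMeasurable b μ →
      AEStronglyMeasurable u μ → AEStronglyMeasurable Du μ → AEStronglyMeasurable f μ →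
      AEStronglyMeasurable F μ → eLpNorm a (ENNReal.ofReal σ₁) μ ≤ M →
      eLpNorm b (ENNReal.ofReal σ₂) μ ≤ M → eLpNorm u (ENNReal.ofReal (sobolevExp n p)) μ ≤ M' →
      eLpNorm Du (ENNReal.ofReal p) μ ≤ M →
      eLpNorm f (ENNReal.ofReal (sobolevExp n p)) μ ≤ S * Y →
      eLpNorm F (ENNReal.ofReal p) μ ≤ Y →
      ∫⁻ x, ‖variationBound q₁ q₂ α β a b u Du f F x‖ₑ ∂μ ≤
        ENNReal.ofReal (δ * (Y : ℝ) ^ p + C * μ.real univ ^ (1 - p / n + ε)) := by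
  have hp0 : 0 < p := by linarith
  have hs := sobolevExp_gt hp1 hpn
  have hn0 : (0 : ℝ) < n := hp0.trans hpn
  have hpn1 : p / n < 1 := (div_lt_one hn0).2 hpn
  have hα := he.α_lt.trans_le (min_le_right _ _)
  have hβ := he.β_lt.trans_le (min_le_right _ _)
  -- The choices L = 2(M + M') + 1 and c = 1 + S majorise the Hölder factors of both terms at once.
  -- Each term receives half of δ.
  obtain ⟨C₁, hC₁, H₁⟩ := exists_lintegral_mul_rpow_mul_rpow_le (σ := σ₁) (P := sobolevExp n p)
    (Q := p) (s := α) (t := q₁) (θ := 1 - p / n + ε) (p := p) (he.σ₁_pos hp1 hpn) (by linarith) hp0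
    he.α_pos.le he.q₁_nonneg (by linarith) (by linarith) (by linarith) M (2 * (M + M') + 1) (1 + S)
    (half_pos hδ)
  obtain ⟨C₂, hC₂, H₂⟩ := exists_lintegral_mul_rpow_mul_rpow_le (σ := σ₂) (P := sobolevExp n p)
    (Q := p) (s := q₂) (t := β) (θ := 1 - p / n + ε) (p := p) (he.σ₂_pos hp1 hpn) (by linarith) hp0
    he.q₂_nonneg he.β_pos.le (by linarith) (by linarith) (by linarith) M (2 * (M + M') + 1) (1 + S)
    (half_pos hδ)
  refine ⟨C₁ + C₂, by positivity, fun μ hμ a b u Du f F Y ham hbm hum hDum hfm hFm ha hb hu hDu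
    hf hF => ?_⟩
  have hf' : eLpNorm (fun x => |f x|) (ENNReal.ofReal (sobolevExp n p)) μ ≤ S * Y :=
    (eLpNorm_norm f).le.trans hf
  have hF' : eLpNorm (fun x => ‖F x‖) (ENNReal.ofReal p) μ ≤ Y := (eLpNorm_norm F).le.trans hF
  have hu' : eLpNorm (fun x => ‖u x‖) (ENNReal.ofReal (sobolevExp n p)) μ ≤ M' :=
    (eLpNorm_norm u).le.trans hu
  have hDu' : eLpNorm (fun x => ‖Du x‖) (ENNReal.ofReal p) μ ≤ M := (eLpNorm_norm Du).le.trans hDu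
  have hfm' : AEStronglyMeasurable (fun x => |f x|) μ := hfm.norm
  have k₁ := H₁ μ hμ a (fun x => |f x|) (fun x => 2 * ‖Du x‖ + ‖F x‖ + 1) ham hfm'
    (((hDum.norm.const_mul 2).add hFm.norm).add aestronglyMeasurable_const) Y ha
    (hf'.trans (by
      push_cast
      calc (S * Y : ℝ≥0∞) ≤ (1 + S) * Y := by gcongr; exact le_add_self
        _ ≤ _ := le_add_self))
    ((eLpNorm_two_mul_add_add_one_le hμ hp1.le hDum.norm hFm.norm).trans (by
      push_cast
      calc _ ≤ 2 * (M : ℝ≥0∞) + Y + 1 := by gcongr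
        _ = 2 * M + 1 + 1 * Y := by ring
        _ ≤ _ := by
          gcongr
          · exact le_self_add
          · exact le_self_add))
  have k₂ := H₂ μ hμ b (fun x => 2 * ‖u x‖ + |f x| + 1) (fun x => ‖F x‖) hbm
    (((hum.norm.const_mul 2).add hfm').add aestronglyMeasurable_const) hFm.norm Y hb
    ((eLpNorm_two_mul_add_add_one_le hμ (by linarith) hum.norm hfm').trans (by
      push_cast
      calc _ ≤ 2 * (M' : ℝ≥0∞) + S * Y + 1 := by gcongr
        _ = 2 * M' + 1 + S * Y := by ring
        _ ≤ _ := by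
          gcongr
          · exact le_add_self
          · exact le_add_self))
    (hF'.trans (by
      push_cast
      calc (Y : ℝ≥0∞) = 1 * Y := (one_mul _).symm
        _ ≤ (1 + S) * Y := by gcongr; exact le_self_add
        _ ≤ _ := le_add_self))
  have hμr : 0 ≤ μ.real univ ^ (1 - p / n + ε) := by positivity
  calc ∫⁻ x, ‖variationBound q₁ q₂ α β a b u Du f F x‖ₑ ∂μ ≤
      ∫⁻ x, (‖a x‖ₑ * ‖|f x|‖ₑ ^ α * ‖2 * ‖Du x‖ + ‖F x‖ + 1‖ₑ ^ q₁ +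
        ‖b x‖ₑ * ‖2 * ‖u x‖ + |f x| + 1‖ₑ ^ q₂ * ‖‖F x‖‖ₑ ^ β) ∂μ := by
        refine lintegral_mono fun x => (enorm_add_le _ _).trans (le_of_eq ?_)
        rw [enorm_mul, enorm_mul, enorm_mul, enorm_mul,
          Real.enorm_rpow_of_nonneg (by positivity) he.α_pos.le,
          Real.enorm_rpow_of_nonneg (by positivity) he.q₁_nonneg,
          Real.enorm_rpow_of_nonneg (by positivity) he.q₂_nonneg,
          Real.enorm_rpow_of_nonneg (by positivity) he.β_pos.le]
    _ ≤ _ := by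
        have hm : AEMeasurable (fun x => ‖a x‖ₑ * ‖|f x|‖ₑ ^ α *
            ‖2 * ‖Du x‖ + ‖F x‖ + 1‖ₑ ^ q₁) μ :=
          (ham.enorm.mul (hfm'.enorm.pow_const _)).mul
            ((((hDum.norm.const_mul 2).add hFm.norm).add
              aestronglyMeasurable_const).enorm.pow_const _)
        rw [lintegral_add_left' hm]
        refine (add_le_add k₁ k₂).trans ?_
        rw [← ENNReal.ofReal_add (by positivity) (by positivity)]
        refine ENNReal.ofReal_le_ofReal (le_of_eq ?_)
        ring

/-! ### Level sets and the test function -/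

theorem nullMeasurableSet_superLevel {n : ℕ} {Ω : Set (Eucl n)} (hΩ : IsOpen Ω) {v : Eucl n → ℝ}
    (hv : AEMeasurable v (volume.restrict Ω)) (k : ℝ) {x₀ : Eucl n} {r : ℝ}
    (hr : Metric.ball x₀ r ⊆ Ω) : NullMeasurableSet (superLevel v k x₀ r) := by
  have h1 : NullMeasurableSet ({x | k < Ω.indicator v x} ∩ Metric.ball x₀ r) volume :=
    (nullMeasurableSet_lt aemeasurable_const
      ((aemeasurable_indicator_iff hΩ.measurableSet).2 hv)).inter
      Metric.isOpen_ball.measurableSet.nullMeasurableSet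
  have h2 : superLevel v k x₀ r = {x | k < Ω.indicator v x} ∩ Metric.ball x₀ r := by
    ext x
    refine and_congr_left fun hx => ?_
    change k < v x ↔ k < Ω.indicator v x
    rw [indicator_of_mem (hr hx)]
  rwa [h2]

theorem aestronglyMeasurable_variationBound {n m : ℕ} {q₁ q₂ α β : ℝ} {a b : Eucl n → ℝ}
    {u : Eucl n → Eucl m} {Du : Eucl n → GradSpace n m} {f : Eucl n → ℝ} {F : Eucl n → Eucl n}
    {μ : Measure (Eucl n)} (ha : AEStronglyMeasurable a μ) (hb : AEStronglyMeasurable b μ)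
    (hu : AEStronglyMeasurable u μ) (hDu : AEStronglyMeasurable Du μ)
    (hf : AEStronglyMeasurable f μ) (hF : AEStronglyMeasurable F μ) :
    AEStronglyMeasurable (variationBound q₁ q₂ α β a b u Du f F) μ := by
  have hfm : AEMeasurable (fun x => |f x|) μ := hf.norm.aemeasurable
  refine AEMeasurable.aestronglyMeasurable (((ha.aemeasurable.mul (hfm.pow_const α)).mul
    (((hDu.norm.aemeasurable.const_mul 2).add hF.norm.aemeasurable).add_const 1 |>.pow_const q₁)).add
    ((hb.aemeasurable.mul ((((hu.norm.aemeasurable.const_mul 2).add hfm).add_const 1).pow_const q₂)).mul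
      (hF.norm.aemeasurable.pow_const β)))

theorem variationBound_eq_zero {n m : ℕ} {q₁ q₂ α β : ℝ} (hα : 0 < α) (hβ : 0 < β)
    {a b : Eucl n → ℝ} {u : Eucl n → Eucl m} {Du : Eucl n → GradSpace n m} {f : Eucl n → ℝ}
    {F : Eucl n → Eucl n} {x : Eucl n} (hf : f x = 0) (hF : F x = 0) :
    variationBound q₁ q₂ α β a b u Du f F x = 0 := by
  simp [variationBound, hf, hF, Real.zero_rpow hα.ne', Real.zero_rpow hβ.ne']

theorem gradient_pow {n : ℕ} {η : Eucl n → ℝ} (hη : ContDiff ℝ ∞ η) (N : ℕ) (x : Eucl n) :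
    gradient (fun x => η x ^ N) x = (N * η x ^ (N - 1)) • gradient η x := by
  have h1 : ContDiff ℝ 1 η := hη.of_le (by exact_mod_cast le_top)
  unfold gradient
  rw [fderiv_fun_pow N (h1.differentiable one_ne_zero x)]
  simp

/-- A zero of a nonnegative function is a minimum. This covers the bounding sphere, so that the test
gradient vanishes at every point off the open super-level part of the ball. -/
theorem gradient_eq_zero_of_nonneg_of_eq_zero {n : ℕ} {η : Eucl n → ℝ} (hη : ∀ x, 0 ≤ η x)
    {x : Eucl n} (hx : η x = 0) : gradient η x = 0 := by
  have h1 : IsLocalMin η x := Filter.Eventually.of_forall fun y => by rw [hx]; exact hη y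
  simp [gradient, h1.fderiv_eq_zero]

theorem MemW1p.cutoff {n : ℕ} {Ω K : Set (Eucl n)} {p : ℝ} {w : Eucl n → ℝ}
    {h : Eucl n → Eucl n} (hw : IsWeakGradient Ω w h) (hK : IsCompact K) (hKΩ : K ⊆ Ω)
    (hwK : MemLp w (ENNReal.ofReal p) (volume.restrict K))
    (hhK : MemLp h (ENNReal.ofReal p) (volume.restrict K)) {ζ : Eucl n → ℝ}
    (hζ : ContDiff ℝ ∞ ζ) (hζK : tsupport ζ ⊆ K) :
    MemW1p univ p (fun x => ζ x * w x) (fun x => ζ x • h x + w x • gradient ζ x) := by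
  have hc : HasCompactSupport ζ := hK.of_isClosed_subset (isClosed_tsupport ζ) hζK
  have hW := hw.cutoff hζ hc (hζK.trans hKΩ)
  obtain ⟨A, hA⟩ := hζ.continuous.bounded_above_of_compact_support hc
  obtain ⟨B, hB⟩ := hζ.continuous_gradient.bounded_above_of_compact_support
    (HasCompactSupport.of_support_subset_isCompact hc fun x hx =>
      by_contra fun hxt => hx (gradient_eq_zero_of_notMem_tsupport hxt))
  have hA0 : 0 ≤ A := (norm_nonneg _).trans (hA 0)
  have hB0 : 0 ≤ B := (norm_nonneg _).trans (hB 0)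
  have hind : ∀ {V : Type} [NormedAddCommGroup V] {f : Eucl n → V},
      MemLp f (ENNReal.ofReal p) (volume.restrict K) →
      MemLp (K.indicator f) (ENNReal.ofReal p) volume :=
    fun hf => (memLp_indicator_iff_restrict hK.measurableSet).2 hf
  rw [MemW1p, Measure.restrict_univ]
  refine ⟨(hind (hwK.norm.const_mul A)).mono
      (locallyIntegrableOn_univ.1 hW.1).aestronglyMeasurable
      (Filter.Eventually.of_forall fun x => ?_),
    (hind ((hhK.norm.const_mul A).add (hwK.norm.const_mul B))).mono
      (locallyIntegrableOn_univ.1 hW.2.1).aestronglyMeasurable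
      (Filter.Eventually.of_forall fun x => ?_), hW⟩
  · by_cases hx : x ∈ K
    · rw [indicator_of_mem hx, norm_mul, norm_mul, norm_norm, Real.norm_of_nonneg hA0]
      exact mul_le_mul_of_nonneg_right (hA x) (norm_nonneg _)
    · rw [image_eq_zero_of_notMem_tsupport fun h => hx (hζK h), zero_mul, norm_zero]
      exact norm_nonneg _
  · by_cases hx : x ∈ K
    · rw [indicator_of_mem hx]
      refine (norm_add_le _ _).trans (le_trans (add_le_add ?_ ?_) (le_abs_self _))
      · rw [norm_smul]
        exact mul_le_mul_of_nonneg_right (hA x) (norm_nonneg _)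
      · rw [norm_smul, mul_comm]
        exact mul_le_mul_of_nonneg_right (hB x) (norm_nonneg _)
    · rw [image_eq_zero_of_notMem_tsupport fun h => hx (hζK h),
        gradient_eq_zero_of_notMem_tsupport fun h => hx (hζK h)]
      simp

theorem MeasureTheory.MemLp.toNNReal_eLpNorm_rpow {X V : Type*} [MeasurableSpace X]
    {μ : Measure X} [NormedAddCommGroup V] {p : ℝ} (hp : 0 < p) {f : X → V}
    (hf : MemLp f (ENNReal.ofReal p) μ) :
    (((eLpNorm f (ENNReal.ofReal p) μ).toNNReal : ℝ≥0) : ℝ) ^ p = ∫ x, ‖f x‖ ^ p ∂μ := by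
  have h0 : 0 ≤ ∫ x, ‖f x‖ ^ p ∂μ := integral_nonneg fun x => by positivity
  rw [hf.eLpNorm_eq_integral_rpow_norm (by simpa using hp) (by simp), ENNReal.toReal_ofReal hp.le]
  change (ENNReal.toReal _) ^ p = _
  rw [ENNReal.toReal_ofReal (by positivity), ← Real.rpow_mul h0, inv_mul_cancel₀ hp.ne',
    Real.rpow_one]

/-! ### The Caccioppoli inequality -/

/-- The Caccioppoli inequality on super-level sets for local minimizers. -/
theorem exists_caccioppoli_superLevel {n : ℕ} (hn : 0 < n) {p : ℝ} (hp1 : 1 < p) (hpn : p < n) :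
    ∃ C₁ : ℝ, 0 < C₁ ∧ ∀ (m : ℕ) (q₁ q₂ α β σ₁ σ₂ : ℝ), ExponentCond n p q₁ q₂ α β σ₁ σ₂ →
    ∀ ε : ℝ, 0 < ε → q₁ / p + α / sobolevExp n p + 1 / σ₁ + ε ≤ p / n →
      β / p + q₂ / sobolevExp n p + 1 / σ₂ + ε ≤ p / n →
    ∀ M M' : ℝ≥0, ∃ C₂ : ℝ, 0 < C₂ ∧
    ∀ (Ω : Set (Eucl n)), IsOpen Ω →
    ∀ (G : Eucl n → Eucl m → GradSpace n m → ℝ) (a b : Eucl n → ℝ),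
      StructureCond Ω q₁ q₂ α β σ₁ σ₂ G a b →
    ∀ (u : Eucl n → Eucl m) (Du : Eucl n → GradSpace n m), IsLocalMinimizer Ω p G u Du →
    ∀ (x₀ : Eucl n) (ρ R : ℝ), 0 < ρ → ρ < R → Metric.closedBall x₀ R ⊆ Ω →
      volume (Metric.closedBall x₀ R) ≤ 1 →
      eLpNorm a (ENNReal.ofReal σ₁) (volume.restrict (Metric.closedBall x₀ R)) ≤ M →
      eLpNorm b (ENNReal.ofReal σ₂) (volume.restrict (Metric.closedBall x₀ R)) ≤ M →
      eLpNorm u (ENNReal.ofReal (sobolevExp n p))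
        (volume.restrict (Metric.closedBall x₀ R)) ≤ M' →
      eLpNorm Du (ENNReal.ofReal p) (volume.restrict (Metric.closedBall x₀ R)) ≤ M →
    ∀ (k : ℝ) (i : Fin m),
      ∫ x in superLevel (fun y => u y i) k x₀ ρ, ‖Du x i‖ ^ p ≤
        C₁ / (R - ρ) ^ p * (∫ x in superLevel (fun y => u y i) k x₀ R, (u x i - k) ^ p) +
          C₂ * volume.real (superLevel (fun y => u y i) k x₀ R) ^ (1 - p / n + ε) := by
  have hp0 : 0 < p := by linarith
  obtain ⟨S, hS⟩ := IsWeakGradient.exists_sobolev hn hp1.le hpn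
  obtain ⟨Cη, hCη, hcut⟩ := exists_radial_cutoff
  obtain ⟨N, hN⟩ := exists_nat_ge p
  have hN1 : 1 < N := by exact_mod_cast hp1.trans_le hN
  have hN0 : N ≠ 0 := by omega
  refine ⟨3 * ((N : ℝ) ^ p * Cη ^ p), by positivity, fun m q₁ q₂ α β σ₁ σ₂ he ε hε h₁ h₂ M M' => ?_⟩
  -- This δ cancels the factor 2^p in ∫|F|^p ≤ 2^p(∫P + ∫Q) and leaves a coefficient 1/2.
  obtain ⟨C, hC, hVB⟩ := exists_lintegral_variationBound_le (m := m) hp1 hpn he hε h₁ h₂ M M' S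
    (δ := (2 * 2 ^ p)⁻¹) (by positivity)
  refine ⟨2 * C, by positivity, fun Ω hΩ G a b hG u Du hu x₀ ρ R hρ hρR hBΩ hvol ha hb hu' hDu k i => ?_⟩
  set K : Set (Eucl n) := Metric.closedBall x₀ R
  set v : Eucl n → ℝ := fun y => u y i
  set A : Set (Eucl n) := superLevel v k x₀ R
  have hKc : IsCompact K := isCompact_closedBall x₀ R
  have hAK : A ⊆ K := inter_subset_right.trans Metric.ball_subset_closedBall
  have hBΩ' : Metric.ball x₀ R ⊆ Ω := Metric.ball_subset_closedBall.trans hBΩ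
  have hle : volume.restrict K ≤ volume.restrict Ω := Measure.restrict_mono hBΩ le_rfl
  have hfinK : IsFiniteMeasure (volume.restrict K) := ⟨by
    rw [Measure.restrict_apply_univ]; exact hKc.measure_lt_top⟩
  obtain ⟨hum, hDum⟩ := hu.1.memLp
  have hvm : AEMeasurable v (volume.restrict Ω) := (hu.1 i).1.1.aemeasurable
  have hAn : NullMeasurableSet A := nullMeasurableSet_superLevel hΩ hvm k hBΩ'
  obtain ⟨η, hη, hηI, hη1, hη0, hηg⟩ := hcut x₀ hρ hρR
  set ζ : Eucl n → ℝ := fun x => η x ^ N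
  set w : Eucl n → ℝ := fun x => max (v x - k) 0
  set h : Eucl n → Eucl n := {x | k < v x}.indicator fun x => Du x i
  have hwg : IsWeakGradient Ω w h := (hu.1 i).2.2.posPart hΩ k
  have hζ : ContDiff ℝ ∞ ζ := hη.pow N
  have hζK : tsupport ζ ⊆ K := closure_minimal (fun x hx => by
    by_contra hxK
    exact hx (by simp [ζ, hη0 x fun h => hxK (Metric.ball_subset_closedBall h),
      hN0])) Metric.isClosed_closedBall
  have hwK : MemLp w (ENNReal.ofReal p) (volume.restrict K) := by
    have h1 := ((hu.1 i).1.mono_measure hle).sub (memLp_const k)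
    refine h1.mono (hwg.1.aestronglyMeasurable.mono_measure hle)
      (Filter.Eventually.of_forall fun x => ?_)
    rw [Real.norm_of_nonneg (le_max_right _ _)]
    exact max_le (le_abs_self _) (abs_nonneg _)
  have hhK : MemLp h (ENNReal.ofReal p) (volume.restrict K) :=
    ((hu.1 i).2.1.mono_measure hle).mono (hwg.2.1.aestronglyMeasurable.mono_measure hle)
      (Filter.Eventually.of_forall fun x => norm_indicator_le_norm_self _ _)
  set f : Eucl n → ℝ := fun x => ζ x * w x
  set F : Eucl n → Eucl n := fun x => ζ x • h x + w x • gradient ζ x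
  have hf : MemW1p univ p f F := MemW1p.cutoff hwg hKc hBΩ hwK hhK hζ hζK
  have hfΩ : MemW1p Ω p f F := ⟨hf.1.mono_measure (Measure.restrict_mono (subset_univ _) le_rfl),
    hf.2.1.mono_measure (Measure.restrict_mono (subset_univ _) le_rfl),
    hf.2.2.mono_set (subset_univ _)⟩
  have hf0 : ∀ x, x ∉ K → f x = 0 := fun x hx => by
    simp [f, image_eq_zero_of_notMem_tsupport fun h => hx (hζK h)]
  have hFeq : ∀ x, F x = η x ^ N • h x + (N * η x ^ (N - 1)) • (w x • gradient η x) := fun x => by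
    simp only [F, ζ, gradient_pow hη]
    rw [smul_comm (w x)]
  set P : Eucl n → ℝ := fun x => η x ^ N * ‖h x‖ ^ p
  set Q : Eucl n → ℝ := fun x => (N : ℝ) ^ p * ‖w x • gradient η x‖ ^ p
  -- All error terms live on A, pointwise; hence the measure of A, not of the ball, enters the
  -- estimate.
  have hoff : ∀ x, x ∉ A → (w x = 0 ∧ h x = 0) ∨ (η x = 0 ∧ gradient η x = 0) := fun x hx => by
    by_cases hxB : x ∈ Metric.ball x₀ R
    · have hk : ¬ k < v x := fun hk => hx ⟨hk, hxB⟩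
      exact Or.inl ⟨max_eq_right (by linarith), indicator_of_notMem (show x ∉ {x | k < v x} from hk) _⟩
    · exact Or.inr ⟨hη0 x hxB,
        gradient_eq_zero_of_nonneg_of_eq_zero (fun x => (hηI x).1) (hη0 x hxB)⟩
  have hPoff : ∀ x, x ∉ A → P x = 0 := fun x hx => by
    rcases hoff x hx with ⟨-, h2⟩ | ⟨h1, -⟩
    · simp [P, h2, Real.zero_rpow hp0.ne']
    · simp [P, h1, hN0]
  have hQoff : ∀ x, x ∉ A → Q x = 0 := fun x hx => by
    rcases hoff x hx with ⟨h1, -⟩ | ⟨-, h2⟩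
    · simp [Q, h1, Real.zero_rpow hp0.ne']
    · simp [Q, h2, Real.zero_rpow hp0.ne']
  have hFoff : ∀ x, x ∉ A → F x = 0 := fun x hx => by
    rw [hFeq]
    rcases hoff x hx with ⟨h1, h2⟩ | ⟨h1, h2⟩
    · simp [h1, h2]
    · simp [h1, h2, hN0]
  have hfoff : ∀ x, x ∉ A → f x = 0 := fun x hx => by
    rcases hoff x hx with ⟨h1, -⟩ | ⟨h1, -⟩
    · simp [f, h1]
    · simp [f, ζ, h1, hN0]
  have hP0 : ∀ x, 0 ≤ P x := fun x => mul_nonneg (pow_nonneg (hηI x).1 _) (by positivity)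
  have hQ0 : ∀ x, 0 ≤ Q x := fun x => by positivity
  have hpt1 : ∀ x, ‖Du x i - F x‖ ^ p ≤ ‖Du x i‖ ^ p - P x + Q x := fun x => by
    by_cases hx : x ∈ A
    · have hh : h x = Du x i := indicator_of_mem (show x ∈ {x | k < v x} from hx.1) _
      have := norm_sub_cutoff_rpow_le hp1 hN (hηI x) (Du x i) (w x • gradient η x)
      rw [hFeq, hh]
      simp only [P, Q, hh]
      linarith
    · rw [hFoff x hx, hPoff x hx, sub_zero, sub_zero]
      linarith [hQ0 x]
  have hpt2 : ∀ x, ‖F x‖ ^ p ≤ 2 ^ p * (P x + Q x) := fun x => by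
    rw [hFeq]
    exact norm_cutoff_rpow_le hp1 (hηI x) (h x) (w x • gradient η x)
  have hPi : IntegrableOn P K := by
    refine (hhK.integrable_norm_rpow_ofReal hp0).mono'
      ((hη.continuous.pow N).aestronglyMeasurable.mul
        (hhK.integrable_norm_rpow_ofReal hp0).1) (Filter.Eventually.of_forall fun x => ?_)
    rw [Real.norm_of_nonneg (hP0 x)]
    exact mul_le_of_le_one_left (by positivity) (pow_le_one₀ (hηI x).1 (hηI x).2)
  have hd : 0 < R - ρ := sub_pos.2 hρR
  have hQle : ∀ x, Q x ≤ (N : ℝ) ^ p * (Cη / (R - ρ)) ^ p * ‖w x‖ ^ p := fun x => by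
    simp only [Q]
    rw [mul_assoc, ← Real.mul_rpow (x := Cη / (R - ρ)) (by positivity) (norm_nonneg _)]
    refine mul_le_mul_of_nonneg_left (Real.rpow_le_rpow (norm_nonneg _) ?_ hp0.le) (by positivity)
    rw [norm_smul, mul_comm]
    exact mul_le_mul_of_nonneg_right (hηg x) (norm_nonneg _)
  have hwi := hwK.integrable_norm_rpow_ofReal hp0
  have hQi : IntegrableOn Q K := by
    have hm : AEStronglyMeasurable (fun x => w x • gradient η x) (volume.restrict K) :=
      hwK.1.smul hη.continuous_gradient.aestronglyMeasurable
    refine (hwi.const_mul ((N : ℝ) ^ p * (Cη / (R - ρ)) ^ p)).mono' ((hm.norm.aemeasurable.pow_const p).const_mul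
      _).aestronglyMeasurable (Filter.Eventually.of_forall fun x => ?_)
    rw [Real.norm_of_nonneg (hQ0 x)]
    exact hQle x
  set VB := variationBound q₁ q₂ α β a b u Du f F
  have hVoff : ∀ x, x ∉ A → VB x = 0 := fun x hx =>
    variationBound_eq_zero he.α_pos he.β_pos (hfoff x hx) (hFoff x hx)
  have hAle : volume.restrict A ≤ volume.restrict K := Measure.restrict_mono hAK le_rfl
  have hFp : MemLp F (ENNReal.ofReal p) volume := by simpa using hf.2.1
  -- The norm is taken over the whole space, where f has compact support, so the Sobolev constant
  -- does not depend on the ball.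
  set Y : ℝ≥0 := (eLpNorm F (ENNReal.ofReal p) volume).toNNReal
  have hY : (Y : ℝ≥0∞) = eLpNorm F (ENNReal.ofReal p) volume := ENNReal.coe_toNNReal hFp.2.ne
  have hAfin : volume A ≤ 1 := (measure_mono hAK).trans hvol
  have hVBm : ∫⁻ x in A, ‖VB x‖ₑ ≤
      ENNReal.ofReal ((2 * 2 ^ p)⁻¹ * (Y : ℝ) ^ p + C * volume.real A ^ (1 - p / n + ε)) := by
    have := hVB (volume.restrict A) (by rwa [Measure.restrict_apply_univ]) a b u Du f F Y
      ((hG.a_mem K hKc hBΩ).1.mono_measure hAle) ((hG.b_mem K hKc hBΩ).1.mono_measure hAle)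
      (hum.1.mono_measure (hAle.trans hle)) (hDum.1.mono_measure (hAle.trans hle))
      (hfΩ.1.1.mono_measure (hAle.trans hle)) (hfΩ.2.1.1.mono_measure (hAle.trans hle))
      ((eLpNorm_mono_measure _ hAle).trans ha) ((eLpNorm_mono_measure _ hAle).trans hb)
      ((eLpNorm_mono_measure _ hAle).trans hu') ((eLpNorm_mono_measure _ hAle).trans hDu)
      ((eLpNorm_mono_measure _ Measure.restrict_le_self).trans (by
        rw [hY]
        exact hS f F hf.2.2 (HasCompactSupport.of_support_subset_isCompact hKc
          fun x hx => by_contra fun hxK => hx (hf0 x hxK))))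
      ((eLpNorm_mono_measure _ Measure.restrict_le_self).trans hY.ge)
    rwa [measureReal_restrict_apply_univ] at this
  have hVBi : Integrable VB := by
    rw [← integrableOn_iff_integrable_of_support_subset (s := A)
      (fun x hx => by_contra fun hxA => hx (hVoff x hxA))]
    exact ⟨aestronglyMeasurable_variationBound
      ((hG.a_mem K hKc hBΩ).1.mono_measure hAle) ((hG.b_mem K hKc hBΩ).1.mono_measure hAle)
      (hum.1.mono_measure (hAle.trans hle)) (hDum.1.mono_measure (hAle.trans hle))
      (hfΩ.1.1.mono_measure (hAle.trans hle)) (hfΩ.2.1.1.mono_measure (hAle.trans hle)),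
      hVBm.trans_lt ENNReal.ofReal_lt_top⟩
  have hmin := hu.setIntegral_rpow_le hp0 he.q₁_nonneg he.q₂_nonneg hG i hKc hBΩ hfΩ hf0
    hVBi.integrableOn
  have hV : ∫ x in K, VB x ≤ (2 * 2 ^ p)⁻¹ * (Y : ℝ) ^ p + C * volume.real A ^ (1 - p / n + ε) := by
    rw [setIntegral_eq_integral_of_forall_compl_eq_zero fun x hx => hVoff x fun h => hx (hAK h),
      ← setIntegral_eq_integral_of_forall_compl_eq_zero hVoff]
    have h1 := (enorm_integral_le_lintegral_enorm (μ := volume.restrict A) VB).trans hVBm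
    rw [Real.enorm_eq_ofReal_abs, ENNReal.ofReal_le_ofReal_iff (by positivity)] at h1
    exact (le_abs_self _).trans h1
  have hYp : (Y : ℝ) ^ p ≤ 2 ^ p * ((∫ x in K, P x) + ∫ x in K, Q x) := by
    rw [hFp.toNNReal_eLpNorm_rpow hp0, ← setIntegral_eq_integral_of_forall_compl_eq_zero (s := K)
      (fun x hx => by rw [hFoff x fun h => hx (hAK h), norm_zero, Real.zero_rpow hp0.ne']),
      ← integral_add hPi hQi, ← integral_const_mul]
    exact integral_mono (hFp.integrable_norm_rpow_ofReal hp0).integrableOn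
      ((hPi.add hQi).const_mul _) hpt2
  have hDi : IntegrableOn (fun x => ‖Du x i‖ ^ p) K :=
    ((hu.1 i).2.1.mono_measure hle).integrable_norm_rpow_ofReal hp0
  have hDFi : IntegrableOn (fun x => ‖Du x i - F x‖ ^ p) K :=
    (((hu.1 i).2.1.sub hfΩ.2.1).mono_measure hle).integrable_norm_rpow_ofReal hp0
  have hDPi : IntegrableOn (fun x => ‖Du x i‖ ^ p - P x) K := hDi.sub hPi
  have hconv : ∫ x in K, ‖Du x i - F x‖ ^ p ≤
      (∫ x in K, ‖Du x i‖ ^ p) - (∫ x in K, P x) + ∫ x in K, Q x := by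
    rw [← integral_sub hDi hPi, ← integral_add hDPi hQi]
    exact integral_mono hDFi (hDPi.add hQi) hpt1
  -- Absorption: ∫P ≤ ∫Q + (∫P + ∫Q)/2 + C|A|^{1−p/n+ε}, which is the origin of the factors 3 and 2.
  have hPQ : ∫ x in K, P x ≤ 3 * (∫ x in K, Q x) + 2 * (C * volume.real A ^ (1 - p / n + ε)) := by
    have h1 : (2 * 2 ^ p)⁻¹ * (Y : ℝ) ^ p ≤ ((∫ x in K, P x) + ∫ x in K, Q x) / 2 := by
      refine (mul_le_mul_of_nonneg_left hYp (by positivity)).trans (le_of_eq ?_)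
      have : (2 : ℝ) ^ p ≠ 0 := by positivity
      field_simp
    linarith
  have hPρ : ∫ x in superLevel v k x₀ ρ, ‖Du x i‖ ^ p ≤ ∫ x in K, P x := by
    have hAρ : NullMeasurableSet (superLevel v k x₀ ρ) :=
      nullMeasurableSet_superLevel hΩ hvm k ((Metric.ball_subset_ball hρR.le).trans hBΩ')
    rw [setIntegral_congr_ae₀ (g := P) hAρ (Filter.Eventually.of_forall fun x hx => by
      have hh : h x = Du x i := indicator_of_mem (show x ∈ {x | k < v x} from hx.1) _
      simp [P, hη1 x hx.2, hh])]
    refine setIntegral_mono_set hPi (Filter.Eventually.of_forall hP0)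
      (LE.le.eventuallyLE fun x hx => ?_)
    exact Metric.ball_subset_closedBall (Metric.ball_subset_ball hρR.le hx.2)
  have hQR : ∫ x in K, Q x ≤ (N : ℝ) ^ p * (Cη / (R - ρ)) ^ p * ∫ x in A, (v x - k) ^ p := by
    have hAw : ∫ x in A, (v x - k) ^ p = ∫ x in A, ‖w x‖ ^ p :=
      setIntegral_congr_ae₀ hAn (Filter.Eventually.of_forall fun x hx => by
        have hk : k < v x := hx.1
        have hw : w x = v x - k := max_eq_left (by linarith)
        rw [hw, Real.norm_of_nonneg (by linarith)])
    rw [setIntegral_eq_integral_of_forall_compl_eq_zero fun x hx => hQoff x fun h => hx (hAK h),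
      ← setIntegral_eq_integral_of_forall_compl_eq_zero hQoff, hAw, ← integral_const_mul]
    exact integral_mono (hQi.mono_set hAK) ((hwi.mono_measure hAle).const_mul _) hQle
  refine hPρ.trans (hPQ.trans ?_)
  have e : 3 * ((N : ℝ) ^ p * Cη ^ p) / (R - ρ) ^ p * (∫ x in A, (v x - k) ^ p) =
      3 * ((N : ℝ) ^ p * (Cη / (R - ρ)) ^ p * ∫ x in A, (v x - k) ^ p) := by
    rw [Real.div_rpow hCη.le hd.le]
    ring
  change _ ≤ 3 * ((N : ℝ) ^ p * Cη ^ p) / (R - ρ) ^ p * (∫ x in A, (v x - k) ^ p) + _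
  rw [e]
  linarith

/-! ### The symmetry u ↦ −u -/

theorem MemW1pVec.neg {n m : ℕ} {Ω : Set (Eucl n)} {p : ℝ} {u : Eucl n → Eucl m}
    {Du : Eucl n → GradSpace n m} (h : MemW1pVec Ω p u Du) : MemW1pVec Ω p (-u) (-Du) :=
  fun i => (h i).neg

theorem StructureCond.neg {n m : ℕ} {Ω : Set (Eucl n)} {q₁ q₂ α β σ₁ σ₂ : ℝ}
    {G : Eucl n → Eucl m → GradSpace n m → ℝ} {a b : Eucl n → ℝ}
    (h : StructureCond Ω q₁ q₂ α β σ₁ σ₂ G a b) :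
    StructureCond Ω q₁ q₂ α β σ₁ σ₂ (fun x s ξ => G x (-s) (-ξ)) a b where
  caratheodory := by
    refine ⟨fun s ξ => h.caratheodory.1 _ _, ?_⟩
    filter_upwards [h.caratheodory.2] with x hx
    exact hx.comp (continuous_fst.neg.prodMk continuous_snd.neg)
  a_nonneg := h.a_nonneg
  b_nonneg := h.b_nonneg
  a_mem := h.a_mem
  b_mem := h.b_mem
  growth := by
    filter_upwards [h.growth] with x hx s₁ s₂ ξ₁ ξ₂
    have := hx (-s₁) (-s₂) (-ξ₁) (-ξ₂)
    rwa [neg_sub_neg, neg_sub_neg, norm_neg, norm_neg, norm_neg, norm_neg, norm_sub_rev s₂,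
      norm_sub_rev ξ₂] at this

theorem energyDensity_neg {n m : ℕ} (p : ℝ) (G : Eucl n → Eucl m → GradSpace n m → ℝ)
    (u : Eucl n → Eucl m) (Du : Eucl n → GradSpace n m) :
    energyDensity p (fun x s ξ => G x (-s) (-ξ)) u Du = energyDensity p G (-u) (-Du) := by
  funext x
  simp [energyDensity]

theorem IsLocalMinimizer.neg {n m : ℕ} {Ω : Set (Eucl n)} {p : ℝ}
    {G : Eucl n → Eucl m → GradSpace n m → ℝ} {u : Eucl n → Eucl m} {Du : Eucl n → GradSpace n m}
    (h : IsLocalMinimizer Ω p G u Du) :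
    IsLocalMinimizer Ω p (fun x s ξ => G x (-s) (-ξ)) (-u) (-Du) := by
  refine ⟨h.1.neg, fun K hK hKΩ => ?_, fun K hK hKΩ φ Dφ hφ hφ0 hint => ?_⟩
  · rw [energyDensity_neg, neg_neg, neg_neg]
    exact h.2.1 K hK hKΩ
  · have e1 : -(-u + φ) = u + -φ := by abel
    have e2 : -(-Du + Dφ) = Du + -Dφ := by abel
    rw [energyDensity_neg, e1, e2] at hint
    have := h.2.2 K hK hKΩ (-φ) (-Dφ) hφ.neg (fun x hx => by simp [hφ0 x hx]) hint
    unfold energy at this ⊢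
    rwa [energyDensity_neg, energyDensity_neg, neg_neg, neg_neg, e1, e2]

theorem subLevel_eq_superLevel_neg {n : ℕ} (v : Eucl n → ℝ) (k : ℝ) (x₀ : Eucl n) (r : ℝ) :
    subLevel v k x₀ r = superLevel (fun x => -v x) (-k) x₀ r := by
  ext x
  refine and_congr_left fun _ => ?_
  change v x < k ↔ -k < -v x
  exact neg_lt_neg_iff.symm

/-! ### Uniform radii, local L^{p*} bounds and the main theorem -/

theorem exists_volume_closedBall_le_one {n : ℕ} (hn : 0 < n) :
    ∃ r : ℝ, 0 < r ∧ ∀ (x : Eucl n) (R : ℝ), 0 < R → R ≤ r →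
      volume (Metric.closedBall x R) ≤ 1 := by
  set c : ℝ := volume.real (Metric.ball (0 : Eucl n) 1)
  have hc : 0 ≤ c := measureReal_nonneg
  refine ⟨1 / (c + 1), by positivity, fun x R hR hRr => ?_⟩
  have hR1 : R ≤ 1 := hRr.trans ((div_le_one (by positivity)).2 (by linarith))
  have h1 := Measure.addHaar_real_closedBall (volume : Measure (Eucl n)) x hR.le
  rw [finrank_euclideanSpace_fin] at h1
  have h2 : R ^ n ≤ R := pow_le_of_le_one hR.le hR1 hn.ne'
  have h3 : R * (c + 1) ≤ 1 := (le_div_iff₀ (by positivity)).1 hRr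
  have h4 : volume.real (Metric.closedBall x R) ≤ 1 := by
    rw [h1]
    nlinarith [pow_nonneg hR.le n]
  have hfin : volume (Metric.closedBall x R) ≠ ⊤ := (isCompact_closedBall x R).measure_lt_top.ne
  rw [← ENNReal.ofReal_toReal hfin]
  exact ENNReal.ofReal_le_one.2 h4

/-- Local higher integrability: on a smaller set the `L^{p*}` norm of a `W^{1,p}` map is bounded by
the norms of the map and of its gradient in `L^p`. -/
theorem exists_eLpNorm_sobolevExp_le {n : ℕ} (hn : 0 < n) {p : ℝ} (hp1 : 1 < p) (hpn : p < n)
    {U K K₁ : Set (Eucl n)} (hU : IsOpen U) (hUK : U ⊆ K) (hK₁ : IsCompact K₁) (hK₁U : K₁ ⊆ U) :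
    ∃ B : ℝ≥0, ∀ (m : ℕ) (Ω : Set (Eucl n)), K ⊆ Ω → ∀ (u : Eucl n → Eucl m)
      (Du : Eucl n → GradSpace n m), MemW1pVec Ω p u Du → ∀ M : ℝ≥0,
      eLpNorm u (ENNReal.ofReal p) (volume.restrict K) ≤ M →
      eLpNorm Du (ENNReal.ofReal p) (volume.restrict K) ≤ M →
      eLpNorm u (ENNReal.ofReal (sobolevExp n p)) (volume.restrict K₁) ≤ (m * (B * M) : ℝ≥0) := by
  obtain ⟨S, hS⟩ := IsWeakGradient.exists_sobolev hn hp1.le hpn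
  -- Sobolev's inequality is applied to each χu^j; χ depends only on the sets, so B does too.
  -- Summing over components costs the factor m.
  obtain ⟨χ, hχ, hχc, hχs, hχ1, hχI⟩ := exists_smooth_cutoff hK₁ hU hK₁U
  obtain ⟨D, hD⟩ := hχ.continuous_gradient.bounded_above_of_compact_support
    (HasCompactSupport.of_support_subset_isCompact hχc fun x hx =>
      by_contra fun hxt => hx (gradient_eq_zero_of_notMem_tsupport hxt))
  have hD0 : 0 ≤ D := (norm_nonneg _).trans (hD 0)
  refine ⟨S * (1 + D.toNNReal), fun m Ω hKΩ u Du hu M huM hDuM => ?_⟩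
  have hle : volume.restrict K ≤ volume.restrict Ω := Measure.restrict_mono hKΩ le_rfl
  have hle₁ : volume.restrict K₁ ≤ volume.restrict Ω :=
    Measure.restrict_mono ((hK₁U.trans hUK).trans hKΩ) le_rfl
  have hp' : 1 ≤ ENNReal.ofReal p := by simpa using hp1.le
  have hs' : 1 ≤ ENNReal.ofReal (sobolevExp n p) := by
    simpa using (hp1.trans (sobolevExp_gt hp1 hpn)).le
  have hcomp : ∀ j : Fin m, eLpNorm (fun x => u x j) (ENNReal.ofReal (sobolevExp n p))
      (volume.restrict K₁) ≤ (S * (1 + D.toNNReal) * M : ℝ≥0) := fun j => by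
    have hw := hu j
    have hχΩ : tsupport χ ⊆ Ω := (hχs.trans hUK).trans hKΩ
    have hW := hw.2.2.cutoff hχ hχc hχΩ
    calc eLpNorm (fun x => u x j) (ENNReal.ofReal (sobolevExp n p)) (volume.restrict K₁)
        = eLpNorm (fun x => χ x * u x j) (ENNReal.ofReal (sobolevExp n p))
            (volume.restrict K₁) := by
          refine eLpNorm_congr_ae ((ae_restrict_iff' hK₁.measurableSet).2
            (Filter.Eventually.of_forall fun x hx => ?_))
          simp only [hχ1 x hx, one_mul]
      _ ≤ eLpNorm (fun x => χ x * u x j) (ENNReal.ofReal (sobolevExp n p)) volume :=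
          eLpNorm_mono_measure _ Measure.restrict_le_self
      _ ≤ S * eLpNorm (fun x => χ x • Du x j + u x j • gradient χ x) (ENNReal.ofReal p) volume :=
          hS _ _ hW hχc.mul_right
      _ = S * eLpNorm (fun x => χ x • Du x j + u x j • gradient χ x) (ENNReal.ofReal p)
            (volume.restrict K) := by
          rw [eLpNorm_restrict_eq_of_support_subset]
          intro x hx
          by_contra hxK
          have hxt : x ∉ tsupport χ := fun h => hxK (hUK (hχs h))
          exact hx (by simp [image_eq_zero_of_notMem_tsupport hxt,
            gradient_eq_zero_of_notMem_tsupport hxt])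
      _ ≤ S * (eLpNorm (fun x => Du x j) (ENNReal.ofReal p) (volume.restrict K) +
            eLpNorm (fun x => D • u x j) (ENNReal.ofReal p) (volume.restrict K)) := by
          gcongr
          have h1 : AEStronglyMeasurable (fun x => Du x j) (volume.restrict K) :=
            hw.2.1.1.mono_measure hle
          have h2 : AEStronglyMeasurable (fun x => u x j) (volume.restrict K) :=
            hw.1.1.mono_measure hle
          refine (eLpNorm_add_le (hχ.continuous.aestronglyMeasurable.smul h1)
            (h2.smul hχ.continuous_gradient.aestronglyMeasurable) hp').trans (add_le_add ?_ ?_)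
          · refine eLpNorm_mono fun x => ?_
            rw [Pi.smul_apply', norm_smul, Real.norm_of_nonneg (hχI x).1]
            exact mul_le_of_le_one_left (norm_nonneg _) (hχI x).2
          · refine eLpNorm_mono fun x => ?_
            rw [Pi.smul_apply', norm_smul, norm_smul, Real.norm_of_nonneg hD0, mul_comm]
            exact mul_le_mul_of_nonneg_right (hD x) (norm_nonneg _)
      _ ≤ S * (M + D.toNNReal * M) := by
          gcongr
          · exact (eLpNorm_mono fun x => PiLp.norm_apply_le (Du x) j).trans hDuM
          · refine (eLpNorm_const_smul D (fun x => u x j) _ _).le.trans ?_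
            rw [Real.enorm_eq_ofReal hD0]
            exact mul_le_mul' le_rfl ((eLpNorm_mono fun x => PiLp.norm_apply_le (u x) j).trans huM)
      _ = _ := by
          push_cast
          ring
  calc eLpNorm u (ENNReal.ofReal (sobolevExp n p)) (volume.restrict K₁)
      ≤ eLpNorm (∑ j : Fin m, fun x => ‖u x j‖) (ENNReal.ofReal (sobolevExp n p))
          (volume.restrict K₁) := by
        refine eLpNorm_mono_real fun x => ?_
        rw [Finset.sum_apply]
        calc ‖u x‖ = ‖∑ j, EuclideanSpace.single j (u x j)‖ := by
              congr 1
              ext l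
              simp [Finset.sum_apply, Pi.single_apply]
          _ ≤ ∑ j, ‖EuclideanSpace.single j (u x j)‖ := norm_sum_le _ _
          _ = ∑ j, ‖u x j‖ := by simp
    _ ≤ ∑ j : Fin m, eLpNorm (fun x => ‖u x j‖) (ENNReal.ofReal (sobolevExp n p))
          (volume.restrict K₁) :=
        eLpNorm_sum_le (fun j _ => ((hu j).1.1.mono_measure hle₁).norm) hs'
    _ ≤ ∑ _j : Fin m, ((S * (1 + D.toNNReal) * M : ℝ≥0) : ℝ≥0∞) :=
        Finset.sum_le_sum fun j _ => (eLpNorm_norm _).le.trans (hcomp j)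
    _ = _ := by
        simp

theorem MemW1p.memW1pLoc_of_subset {n : ℕ} {Ω Ω' : Set (Eucl n)} {p : ℝ} {v : Eucl n → ℝ}
    {g : Eucl n → Eucl n} (h : MemW1p Ω p v g) (hsub : Ω' ⊆ Ω) : MemW1pLoc Ω' p v g :=
  ⟨fun _ _ hK => ⟨h.1.mono_measure (Measure.restrict_mono (hK.trans hsub) le_rfl),
    h.2.1.mono_measure (Measure.restrict_mono (hK.trans hsub) le_rfl)⟩, h.2.2.mono_set hsub⟩

theorem theorem2 (n : ℕ) (hn : 2 ≤ n) (p : ℝ) (hp1 : 1 < p) (hpn : p < n) :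
    ∃ C₁ : ℝ, 0 < C₁ ∧
    ∀ (Ω : Set (Eucl n)), IsOpen Ω → ∀ (S : Set (Eucl n)), IsCompact S → S ⊆ Ω →
    ∃ (R₀ : ℝ) (K : Set (Eucl n)),
      0 < R₀ ∧ IsCompact K ∧ K ⊆ Ω ∧ Metric.cthickening R₀ S ⊆ K ∧
    ∀ (m : ℕ), 1 ≤ m → ∀ (q₁ q₂ α β σ₁ σ₂ : ℝ), ExponentCond n p q₁ q₂ α β σ₁ σ₂ →
    ∀ ε : ℝ, 0 < ε →
      q₁ / p + α / sobolevExp n p + 1 / σ₁ + ε ≤ p / n →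
      β / p + q₂ / sobolevExp n p + 1 / σ₂ + ε ≤ p / n →
    ∀ M : ℝ≥0,
    ∃ C₂ : ℝ, 0 < C₂ ∧
    ∀ (G : Eucl n → Eucl m → GradSpace n m → ℝ) (a b : Eucl n → ℝ),
      StructureCond Ω q₁ q₂ α β σ₁ σ₂ G a b →
      eLpNorm a (ENNReal.ofReal σ₁) (volume.restrict K) ≤ M →
      eLpNorm b (ENNReal.ofReal σ₂) (volume.restrict K) ≤ M →
    ∀ (u : Eucl n → Eucl m) (Du : Eucl n → GradSpace n m),
      IsLocalMinimizer Ω p G u Du →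
      eLpNorm u (ENNReal.ofReal p) (volume.restrict K) ≤ M →
      eLpNorm Du (ENNReal.ofReal p) (volume.restrict K) ≤ M →
      (∀ ρ R : ℝ, 0 < ρ → ρ < R → R < R₀ → ∀ x₀ ∈ S, ∀ (k : ℝ) (i : Fin m),
        (∫ x in superLevel (fun y => u y i) k x₀ ρ, ‖Du x i‖ ^ p ≤
          C₁ / (R - ρ) ^ p * (∫ x in superLevel (fun y => u y i) k x₀ R, (u x i - k) ^ p) +
            C₂ * volume.real (superLevel (fun y => u y i) k x₀ R) ^ (1 - p / n + ε)) ∧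
        (∫ x in subLevel (fun y => u y i) k x₀ ρ, ‖Du x i‖ ^ p ≤
          C₁ / (R - ρ) ^ p * (∫ x in subLevel (fun y => u y i) k x₀ R, (k - u x i) ^ p) +
            C₂ * volume.real (subLevel (fun y => u y i) k x₀ R) ^ (1 - p / n + ε))) ∧
      (∀ Ω' : Set (Eucl n), IsOpen Ω' → Ω' ⊆ S → ∀ i : Fin m,
        MemDeGiorgi Ω' p C₁ C₂ 1 ε R₀ 0 (fun y => u y i)) := by
  have hn0 : 0 < n := by omega
  obtain ⟨C₁, hC₁, hcacc⟩ := exists_caccioppoli_superLevel hn0 hp1 hpn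
  refine ⟨C₁, hC₁, fun Ω hΩ S hS hSΩ => ?_⟩
  obtain ⟨δ, hδ, hδΩ⟩ := hS.exists_cthickening_subset_open hΩ hSΩ
  obtain ⟨r, hr, hvol⟩ := exists_volume_closedBall_le_one hn0
  obtain ⟨B, hB⟩ := exists_eLpNorm_sobolevExp_le hn0 hp1 hpn (U := Metric.thickening δ S)
    (K := Metric.cthickening δ S) (K₁ := Metric.cthickening (δ / 2) S) Metric.isOpen_thickening
    (Metric.thickening_subset_cthickening δ S) hS.cthickening
    (Metric.cthickening_subset_thickening' hδ (half_lt_self hδ) S)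
  -- Radii below δ/2 keep the balls in the smaller neighbourhood, where u is bounded in L^{p*} by
  -- its norms on the larger one; radii below r make their volume at most 1.
  have hR₀ : 0 < min (δ / 2) r := lt_min (half_pos hδ) hr
  refine ⟨min (δ / 2) r, Metric.cthickening δ S, hR₀, hS.cthickening, hδΩ,
    Metric.cthickening_mono ((min_le_left _ _).trans (half_le_self hδ.le)) S, ?_⟩
  intro m _ q₁ q₂ α β σ₁ σ₂ he ε hε h₁ h₂ M
  obtain ⟨C₂, hC₂, hmain⟩ := hcacc m q₁ q₂ α β σ₁ σ₂ he ε hε h₁ h₂ M (m * (B * M))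
  refine ⟨C₂, hC₂, fun G a b hG ha hb u Du hu huM hDuM => ?_⟩
  have huS := hB m Ω hδΩ u Du hu.1 M huM hDuM
  have hest : ∀ ρ R : ℝ, 0 < ρ → ρ < R → R < min (δ / 2) r → ∀ x₀ ∈ S, ∀ (k : ℝ) (i : Fin m),
      (∫ x in superLevel (fun y => u y i) k x₀ ρ, ‖Du x i‖ ^ p ≤
        C₁ / (R - ρ) ^ p * (∫ x in superLevel (fun y => u y i) k x₀ R, (u x i - k) ^ p) +
          C₂ * volume.real (superLevel (fun y => u y i) k x₀ R) ^ (1 - p / n + ε)) ∧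
      (∫ x in subLevel (fun y => u y i) k x₀ ρ, ‖Du x i‖ ^ p ≤
        C₁ / (R - ρ) ^ p * (∫ x in subLevel (fun y => u y i) k x₀ R, (k - u x i) ^ p) +
          C₂ * volume.real (subLevel (fun y => u y i) k x₀ R) ^ (1 - p / n + ε)) := by
    intro ρ R hρ hρR hR x₀ hx₀ k i
    have hsub₁ : Metric.closedBall x₀ R ⊆ Metric.cthickening (δ / 2) S :=
      (Metric.closedBall_subset_closedBall (hR.le.trans (min_le_left _ _))).trans
        (Metric.closedBall_subset_cthickening hx₀ _)
    have hsub : Metric.closedBall x₀ R ⊆ Metric.cthickening δ S :=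
      hsub₁.trans (Metric.cthickening_mono (half_le_self hδ.le) S)
    have hle := Measure.restrict_mono (μ := (volume : Measure (Eucl n))) hsub le_rfl
    have hle₁ := Measure.restrict_mono (μ := (volume : Measure (Eucl n))) hsub₁ le_rfl
    have hv := hvol x₀ R (hρ.trans hρR) (hR.le.trans (min_le_right _ _))
    constructor
    · exact hmain Ω hΩ G a b hG u Du hu x₀ ρ R hρ hρR (hsub.trans hδΩ) hv
        ((eLpNorm_mono_measure _ hle).trans ha) ((eLpNorm_mono_measure _ hle).trans hb)
        ((eLpNorm_mono_measure _ hle₁).trans huS) ((eLpNorm_mono_measure _ hle).trans hDuM) k i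
    -- The set {u^i < k} is the super-level set of −u^i at level −k; the norms of the data do not
    -- change, so the same C₂ serves.
    · have := hmain Ω hΩ _ a b hG.neg (-u) (-Du) hu.neg x₀ ρ R hρ hρR (hsub.trans hδΩ) hv
        ((eLpNorm_mono_measure _ hle).trans ha) ((eLpNorm_mono_measure _ hle).trans hb)
        (by rw [eLpNorm_neg]; exact (eLpNorm_mono_measure _ hle₁).trans huS)
        (by rw [eLpNorm_neg]; exact (eLpNorm_mono_measure _ hle).trans hDuM) (-k) i
      simp only [Pi.neg_apply, PiLp.neg_apply, norm_neg, neg_sub_neg] at this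
      simpa only [subLevel_eq_superLevel_neg] using this
  refine ⟨hest, fun Ω' hΩ' hΩ'S i => ?_⟩
  have hloc : MemW1pLoc Ω' p (fun y => u y i) fun x => Du x i :=
    (hu.1 i).memW1pLoc_of_subset (hΩ'S.trans hSΩ)
  have hbdd : Bornology.IsBounded Ω' := hS.isBounded.subset hΩ'S
  -- With χ = 1 the De Giorgi bracket is 1 plus a nonnegative term, so it only weakens the estimate.
  have hmono : ∀ {t s V : ℝ}, 0 ≤ t → 0 ≤ s → 0 ≤ V →
      C₂ * V ≤ C₂ * (1 ^ p + t ^ p * s) * V := fun {t s V} ht hs hV => by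
    rw [Real.one_rpow]
    have : 0 ≤ t ^ p * s := by positivity
    nlinarith [mul_nonneg hC₂.le hV, mul_nonneg (mul_nonneg hC₂.le hV) this]
  constructor
  · refine ⟨hΩ', hbdd, hp1, hC₁, hC₂, one_pos, hε, hR₀, le_rfl, _, hloc,
      fun k hk x₀ ρ R hρ hρR hR hball => ?_⟩
    have hR0 : 0 < R := hρ.trans hρR
    refine (hest ρ R hρ hρR hR x₀ (hΩ'S (hball (Metric.mem_closedBall_self hR0.le))) k i).1.trans
      (add_le_add_right (hmono hk (by positivity) (by positivity)) _)
  · refine ⟨hΩ', hbdd, hp1, hC₁, hC₂, one_pos, hε, hR₀, le_rfl, _, hloc,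
      fun k hk x₀ ρ R hρ hρR hR hball => ?_⟩
    have hR0 : 0 < R := hρ.trans hρR
    refine (hest ρ R hρ hρR hR x₀ (hΩ'S (hball (Metric.mem_closedBall_self hR0.le))) k i).2.trans
      (add_le_add_right (hmono (abs_nonneg k) (by positivity) (by positivity)) _)
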